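/- Let $H\in(0,1)$, $\kappa>0$. For functions $f$ of $(s,y)\in\mathbb R_+\times\mathbb R$ write $\mathcal Ff(s,\xi)=\int_{\mathbb R}e^{-i\xi y}f(s,y)\,dy$ for the Fourier transform in the space variable only. Let $W=\{W(\phi):\phi\in\mathcal D((0,\infty)\times\mathbb R)\}$ be a zero-mean Gaussian family on a probability space, indexed by the real-valued smooth compactly supported functions on $(0,\infty)\times\mathbb R$, with covariance $$\mathbb E[W(\phi)W(\psi)]=c_{1,H}\int_{\mathbb R_+\times\mathbb R}\mathcal F\phi(s,\xi)\overline{\mathcal F\psi(s,\xi)}\,|\xi|^{1-2H}\,ds\,d\xi,\qquad c_{1,H}=\frac{1}{2\pi}\Gamma(2H+1)\sin(H\pi)$$ (a noise that is white in time and fractional with Hurst parameter $H$ in space). Let $p_t(x)=(2\pi\kappa t)^{-1/2}e^{-x^2/(2\kappa t)}$, and let $u=\{u_t(x):t\ge 0,\ x\in\mathbb R\}$ be the stochastic convolution, that is, the solution with zero initial condition of $\partial_t u=\frac{\kappa}{2}\partial_x^2u+\dot W$: for every $t\ge0$ and $x\in\mathbb R$, $$u_t(x)=\int_0^t\int_{\mathbb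 R}p_{t-s}(x-y)\,W(ds,dy)\quad\text{a.s.},$$ where the integral is the Wiener integral, i.e. the isometric extension of $\phi\mapsto W(\phi)$ to the closure of the test functions for the norm $\big(c_{1,H}\int_{\mathbb R_+\times\mathbb R}|\mathcal F\phi(s,\xi)|^2|\xi|^{1-2H}ds\,d\xi\big)^{1/2}$, with values in $L^2(\mathbb P)$. Let $\mathcal N$ be a standard normal random variable and put $$C_{1,H,\kappa}=\left(\frac{2^{1-H}\Gamma(2H)}{\kappa^{1-H}\Gamma(H)}\right)^{1/2},\qquad C_{2,H,\kappa}=\kappa^{-1/2}.$$ Then for every $x\in\mathbb R$ and every $0\le a\le b$, $$\lim_{n\to\infty}\sum_{a2^n\le i\le b2^n}\left|u_{(i+1)/2^n}(x)-u_{i/2^n}(x)\right|^{2/H}=(b-a)\,C_{1,H,\kappa}^{2/H}\,\mathbb E\left[|\mathcal N|^{2/H}\right]\quad\text{a.s.},$$ and for every $t>0$ and all real $c\le d$, $$\lim_{n\to\infty}\sum_{c2^n\le i\le d2^n}\left|u_t((i+1)/2^n)-u_t(i/2^n)\right|^{1/H}=(d-c)\,C_{2,H,\kappa}^{1/H}\,\mathbb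 E\left[|\mathcal N|^{1/H}\right]\quad\text{a.s.},$$ the sums being over integers $i$. -/

import Mathlib

open MeasureTheory ProbabilityTheory Filter Topology Set
open scoped Distributions ENNReal

noncomputable section

namespace FracHeat

/-- The open half plane `(0, ∞) × ℝ` of points (time, space). -/
def openHalfPlane : TopologicalSpace.Opens (ℝ × ℝ) :=
  ⟨Ioi (0 : ℝ) ×ˢ univ, isOpen_Ioi.prod isOpen_univ⟩

/-- `𝒟((0, ∞) × ℝ)`: smooth, compactly supported, real-valued functions on `(0, ∞) × ℝ`. -/
abbrev TestFun : Type := 𝓓(openHalfPlane, ℝ)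

/-- Fourier transform in the space variable only:
`(s, ξ) ↦ ∫ exp (- i ξ y) f (s, y) dy`. -/
def spaceFourier (f : ℝ × ℝ → ℝ) (z : ℝ × ℝ) : ℂ :=
  ∫ y : ℝ, Complex.exp (-(Complex.I * (z.2 : ℂ) * (y : ℂ))) * (f (z.1, y) : ℂ)

/-- `c_{1,H} = Γ(2H+1) sin(Hπ) / (2π)`. -/
def noiseConst (H : ℝ) : ℝ :=
  1 / (2 * Real.pi) * Real.Gamma (2 * H + 1) * Real.sin (H * Real.pi)

/-- The measure `c_{1,H} |ξ|^{1-2H} ds dξ` on `ℝ₊ × ℝ`. -/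
def spectralMeasure (H : ℝ) : Measure (ℝ × ℝ) :=
  (volume.restrict (Ioi (0 : ℝ) ×ˢ univ)).withDensity
    (fun z => ENNReal.ofReal (noiseConst H * |z.2| ^ (1 - 2 * H)))

/-- The Gaussian noise, white in time and fractional with Hurst parameter `H` in space: a
zero-mean Gaussian family indexed by `𝒟((0, ∞) × ℝ)` with covariance
`E[W(φ) W(ψ)] = c_{1,H} ∫_{ℝ₊ × ℝ} ℱφ(s,ξ) conj(ℱψ(s,ξ)) |ξ|^{1-2H} ds dξ`. -/
structure IsFractionalNoise {Ω : Type*} [MeasurableSpace Ω] (H : ℝ) (P : Measure Ω)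
    (W : TestFun → Ω → ℝ) : Prop where
  gaussian : IsGaussianProcess W P
  mean_zero : ∀ φ : TestFun, ∫ ω, W φ ω ∂P = 0
  covariance : ∀ φ ψ : TestFun,
    ((∫ ω, W φ ω * W ψ ω ∂P : ℝ) : ℂ) =
      ∫ z, spaceFourier φ z * (starRingEnd ℂ) (spaceFourier ψ z) ∂(spectralMeasure H)

/-- `I` is (a version of) the Wiener integral `∫_{ℝ₊} ∫_ℝ g(s,y) W(ds,dy)` of the deterministic
integrand `g`, whose time slices are integrable: `I` is the `L²(P)`-limit of `W(φ_k)` for some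
test functions `φ_k` that converge to `g` in the norm
`(c_{1,H} ∫_{ℝ₊ × ℝ} |ℱf(s,ξ)|² |ξ|^{1-2H} ds dξ)^{1/2}` of the Hilbert space of the noise. -/
structure IsWienerIntegral {Ω : Type*} [MeasurableSpace Ω] (H : ℝ) (P : Measure Ω)
    (W : TestFun → Ω → ℝ) (g : ℝ × ℝ → ℝ) (I : Ω → ℝ) : Prop where
  integrable_slice : ∀ᵐ s ∂(volume.restrict (Ioi (0 : ℝ))), Integrable (fun y : ℝ => g (s, y))
  memLp : MemLp I 2 P
  exists_approx : ∃ φ : ℕ → TestFun,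
    Tendsto (fun k => eLpNorm (fun z => spaceFourier (φ k) z - spaceFourier g z) 2
      (spectralMeasure H)) atTop (𝓝 0) ∧
    Tendsto (fun k => eLpNorm (fun ω => W (φ k) ω - I ω) 2 P) atTop (𝓝 0)

/-- The heat kernel `p_t(x) = (2πκt)^{-1/2} exp(-x²/(2κt))` of `(κ/2) Δ`, for `t > 0`. -/
def heatKernel (κ t x : ℝ) : ℝ :=
  1 / Real.sqrt (2 * Real.pi * κ * t) * Real.exp (-(x ^ 2 / (2 * κ * t)))

/-- The integrand `(s, y) ↦ 1_{0 < s < t} p_{t-s}(x-y)`. -/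
def convKernel (κ t x : ℝ) (z : ℝ × ℝ) : ℝ :=
  if 0 < z.1 ∧ z.1 < t then heatKernel κ (t - z.1) (x - z.2) else 0

/-- The random field `u` on `ℝ₊ × ℝ` is the stochastic convolution driven by `W`: for all `t ≥ 0`
and `x`, almost surely `u_t(x) = ∫_0^t ∫_ℝ p_{t-s}(x-y) W(ds,dy)`. No path regularity and no
joint measurability of `u` is required. Values at negative times are irrelevant. -/
def IsStochasticConvolution {Ω : Type*} [MeasurableSpace Ω] (H κ : ℝ) (P : Measure Ω)
    (W : TestFun → Ω → ℝ) (u : ℝ → ℝ → Ω → ℝ) : Prop :=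
  ∀ t x : ℝ, 0 ≤ t → IsWienerIntegral H P W (convKernel κ t x) (u t x)

/-- `∑_{a 2^n ≤ i ≤ b 2^n} |f((i+1)/2^n) - f(i/2^n)|^p`, the sum being over integers `i`. -/
def dyadicVariation (f : ℝ → ℝ) (p a b : ℝ) (n : ℕ) : ℝ :=
  ∑ i ∈ Finset.Icc ⌈a * 2 ^ n⌉ ⌊b * 2 ^ n⌋,
    |f (((i : ℝ) + 1) / 2 ^ n) - f ((i : ℝ) / 2 ^ n)| ^ p

/-- `C_{1,H,κ} = (2^{1-H} Γ(2H) / (κ^{1-H} Γ(H)))^{1/2}`. -/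
def timeConst (H κ : ℝ) : ℝ :=
  ((2 : ℝ) ^ (1 - H) * Real.Gamma (2 * H) / (κ ^ (1 - H) * Real.Gamma H)) ^ (1 / 2 : ℝ)

/-- `C_{2,H,κ} = κ^{-1/2}`. -/
def spaceConst (κ : ℝ) : ℝ := κ ^ (-(1 / 2) : ℝ)

/-- `E[|N|^p]` for a standard normal random variable `N`. -/
def normalAbsMoment (p : ℝ) : ℝ := ∫ z, |z| ^ p ∂(gaussianReal 0 1)

end FracHeat

end

/-! The noise isometry makes every second moment of `u` an explicit spectral integral, because the
space Fourier transform of the heat kernel is a Gaussian times a phase. At a fixed point, E[u_t u_s]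
= A((t+s)^H - |t-s|^H) with A = `timeCoeff`. At a fixed time, the covariance at distance d is a
constant minus |d|^{2H}/(2κ) plus `spaceRemainder`, which is O(d²). Hence increments over a step h
have variance close to 2A h^H in time and h^{2H}/κ in space.

Put N = 2^n, with α = H in time and α = 2H in space, and p = 2/α. The increments are centred and
jointly Gaussian with variance of order N^{-α}, so the p-th absolute moment of each is of order 1/N.
Summing about (b-a)N of them gives the limiting mean.

For the fluctuations, the covariance of |X|^p and |Y|^p is at most C s^{p-1}|E[XY]| when both
variances are at most s (`abs_integral_abs_rpow_mul_sub_le`). This linear bound follows from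
regressing Y on X and is weaker than the quadratic one from Hermite expansions, but it suffices. The
increment covariances are second differences of |·|^α, of constant sign away from the diagonal, so
their row sums telescope. They are O(N^{-α}) if α ≤ 1 and O(N^{-1}) if α > 1
(`sum_abs_secondDiff_sub_le`). The variance of the power variation is therefore bounded by a
geometric sequence in n, and summable variances with convergent means give almost sure convergence
(`ae_tendsto_dyadic_sum`). Only countably many random variables enter, so no path regularity is
needed. -/

noncomputable section

namespace FracHeat

/-! ### Continuity of the L² inner product. -/

section LTwo

variable {α 𝕜 : Type*} [RCLike 𝕜] {mα : MeasurableSpace α} {μ : Measure α}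

/-- The `L²` inner product is jointly continuous. -/
theorem tendsto_integral_mul_conj {f g : α → 𝕜} {F G : ℕ → α → 𝕜}
    (hf : MemLp f 2 μ) (hg : MemLp g 2 μ) (hF : ∀ k, MemLp (F k) 2 μ) (hG : ∀ k, MemLp (G k) 2 μ)
    (hFf : Tendsto (fun k => eLpNorm (fun z => F k z - f z) 2 μ) atTop (𝓝 0))
    (hGg : Tendsto (fun k => eLpNorm (fun z => G k z - g z) 2 μ) atTop (𝓝 0)) :
    Tendsto (fun k => ∫ z, F k z * (starRingEnd 𝕜) (G k z) ∂μ) atTop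
      (𝓝 (∫ z, f z * (starRingEnd 𝕜) (g z) ∂μ)) := by
  have key : ∀ {u v : α → 𝕜} (hu : MemLp u 2 μ) (hv : MemLp v 2 μ),
      ∫ z, u z * (starRingEnd 𝕜) (v z) ∂μ = inner 𝕜 (hv.toLp v) (hu.toLp u) := by
    intro u v hu hv
    rw [L2.inner_def]
    refine integral_congr_ae ?_
    filter_upwards [hu.coeFn_toLp, hv.coeFn_toLp] with z h1 h2
    rw [h1, h2, RCLike.inner_apply]
  have h1 : Tendsto (fun k => (hF k).toLp (F k)) atTop (𝓝 (hf.toLp f)) :=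
    (Lp.tendsto_Lp_iff_tendsto_eLpNorm'' F hF f hf).2 hFf
  have h2 : Tendsto (fun k => (hG k).toLp (G k)) atTop (𝓝 (hg.toLp g)) :=
    (Lp.tendsto_Lp_iff_tendsto_eLpNorm'' G hG g hg).2 hGg
  simp_rw [key (hF _) (hG _), key hf hg]
  exact h2.inner h1

theorem tendsto_integral_mul_of_tendsto_eLpNorm {f g : α → ℝ} {F G : ℕ → α → ℝ}
    (hf : MemLp f 2 μ) (hg : MemLp g 2 μ) (hF : ∀ k, MemLp (F k) 2 μ) (hG : ∀ k, MemLp (G k) 2 μ)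
    (hFf : Tendsto (fun k => eLpNorm (fun z => F k z - f z) 2 μ) atTop (𝓝 0))
    (hGg : Tendsto (fun k => eLpNorm (fun z => G k z - g z) 2 μ) atTop (𝓝 0)) :
    Tendsto (fun k => ∫ z, F k z * G k z ∂μ) atTop (𝓝 (∫ z, f z * g z ∂μ)) := by
  simpa using tendsto_integral_mul_conj hf hg hF hG hFf hGg

end LTwo

/-! ### Stability of Gaussian laws under L² limits. -/

section Gaussian

variable {Ω : Type*} [MeasurableSpace Ω] {P : Measure Ω} [IsProbabilityMeasure P]

theorem integral_eq_zero_of_tendsto_eLpNorm {Z : Ω → ℝ} {Y : ℕ → Ω → ℝ}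
    (hY : ∀ k, MemLp (Y k) 2 P) (hY0 : ∀ k, ∫ ω, Y k ω ∂P = 0) (hZ : MemLp Z 2 P)
    (h : Tendsto (fun k => eLpNorm (fun ω => Y k ω - Z ω) 2 P) atTop (𝓝 0)) :
    ∫ ω, Z ω ∂P = 0 := by
  have h1 := tendsto_integral_mul_of_tendsto_eLpNorm (μ := P) hZ (memLp_const (1 : ℝ)) hY
    (fun _ => memLp_const (1 : ℝ)) h (by simp)
  simp only [mul_one, hY0] at h1
  exact (tendsto_nhds_unique h1 tendsto_const_nhds)

/-- An `L²`-limit of centred real Gaussian variables is Gaussian. -/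
theorem hasGaussianLaw_of_tendsto_eLpNorm {Z : Ω → ℝ} {Y : ℕ → Ω → ℝ}
    (hY : ∀ k, HasGaussianLaw (Y k) P) (hY0 : ∀ k, ∫ ω, Y k ω ∂P = 0) (hZ : MemLp Z 2 P)
    (h : Tendsto (fun k => eLpNorm (fun ω => Y k ω - Z ω) 2 P) atTop (𝓝 0)) :
    HasGaussianLaw Z P := by
  have hZ0 := integral_eq_zero_of_tendsto_eLpNorm (fun k => (hY k).memLp_two) hY0 hZ h
  have hvar := tendsto_integral_mul_of_tendsto_eLpNorm hZ hZ (fun k => (hY k).memLp_two)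
    (fun k => (hY k).memLp_two) h h
  have hmeas : TendstoInMeasure P Y atTop Z :=
    tendstoInMeasure_of_tendsto_eLpNorm (by norm_num) (fun k => (hY k).aemeasurable.aestronglyMeasurable)
      hZ.aestronglyMeasurable h
  have hdist := hmeas.tendstoInDistribution_of_aemeasurable (fun k => (hY k).aemeasurable)
    hZ.aestronglyMeasurable.aemeasurable
  have hchar := ProbabilityMeasure.tendsto_iff_tendsto_charFun.1 hdist.tendsto
  rw [hasGaussianLaw_iff_charFun_map_eq hZ.aestronglyMeasurable.aemeasurable]
  intro t
  have hvarY : ∀ {X : Ω → ℝ}, MemLp X 2 P → ∫ ω, X ω ∂P = 0 →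
      Var[fun ω => inner ℝ t (X ω); P] = t ^ 2 * ∫ ω, X ω * X ω ∂P := by
    intro X hX hX0
    have : (fun ω => inner ℝ t (X ω)) = fun ω => t * X ω := by
      ext ω; simp [mul_comm]
    rw [this, variance_const_mul, variance_of_integral_eq_zero hX.aestronglyMeasurable.aemeasurable hX0]
    simp [pow_two]
  have hmean : ∀ {X : Ω → ℝ}, ∫ ω, X ω ∂P = 0 → ∫ ω, inner ℝ t (X ω) ∂P = 0 := by
    intro X hX0
    have : (fun ω => inner ℝ t (X ω)) = fun ω => t * X ω := by
      ext ω; simp [mul_comm]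
    rw [this, integral_const_mul, hX0, mul_zero]
  have h1 := hchar t
  simp only [ProbabilityMeasure.coe_mk] at h1
  -- A centred Gaussian characteristic function depends only on the variance, and variances converge
  -- in L². So the limit of the characteristic functions is the Gaussian one with the limiting
  -- variance.
  refine tendsto_nhds_unique h1 ?_
  have h2 : ∀ k, charFun (P.map (Y k)) t =
      Complex.exp (-((t ^ 2 * ∫ ω, Y k ω * Y k ω ∂P : ℝ) : ℂ) / 2) := by
    intro k
    rw [(hasGaussianLaw_iff_charFun_map_eq (hY k).aemeasurable).1 (hY k) t,
      hmean (hY0 k), hvarY (hY k).memLp_two (hY0 k)]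
    simp [neg_div]
  simp_rw [h2]
  rw [hmean hZ0, hvarY hZ hZ0]
  have h3 : Tendsto (fun k => t ^ 2 * ∫ ω, Y k ω * Y k ω ∂P) atTop
      (𝓝 (t ^ 2 * ∫ ω, Z ω * Z ω ∂P)) := hvar.const_mul _
  have h4 := (Complex.continuous_ofReal.tendsto _).comp h3
  have h5 := (Complex.continuous_exp.tendsto _).comp (h4.neg.div_const 2)
  simpa [Function.comp_def, neg_div] using h5

/-- Joint `L²`-limits of Gaussian pairs are Gaussian. -/
theorem hasGaussianLaw_prodMk_of_tendsto_eLpNorm {Z₁ Z₂ : Ω → ℝ} {Y₁ Y₂ : ℕ → Ω → ℝ}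
    (hY : ∀ k, HasGaussianLaw (fun ω => (Y₁ k ω, Y₂ k ω)) P)
    (hY₁ : ∀ k, ∫ ω, Y₁ k ω ∂P = 0) (hY₂ : ∀ k, ∫ ω, Y₂ k ω ∂P = 0)
    (hZ₁ : MemLp Z₁ 2 P) (hZ₂ : MemLp Z₂ 2 P)
    (h₁ : Tendsto (fun k => eLpNorm (fun ω => Y₁ k ω - Z₁ ω) 2 P) atTop (𝓝 0))
    (h₂ : Tendsto (fun k => eLpNorm (fun ω => Y₂ k ω - Z₂ ω) 2 P) atTop (𝓝 0)) :
    HasGaussianLaw (fun ω => (Z₁ ω, Z₂ ω)) P := by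
  have hmeas : AEMeasurable (fun ω => (Z₁ ω, Z₂ ω)) P :=
    hZ₁.aestronglyMeasurable.aemeasurable.prodMk hZ₂.aestronglyMeasurable.aemeasurable
  -- A law on the plane is Gaussian once all its linear functionals are, which reduces the pair to
  -- the one-dimensional limit theorem.
  have hlin : ∀ L : StrongDual ℝ (ℝ × ℝ), HasGaussianLaw (fun ω => L (Z₁ ω, Z₂ ω)) P := by
    intro L
    have hL : ∀ x y : ℝ, L (x, y) = L (1, 0) * x + L (0, 1) * y := by
      intro x y
      have : (x, y) = x • ((1 : ℝ), (0 : ℝ)) + y • ((0 : ℝ), (1 : ℝ)) := by simp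
      rw [this, map_add, map_smul, map_smul, smul_eq_mul, smul_eq_mul]; ring
    have m₁ := fun k => (hY k).fst.memLp_two
    have m₂ := fun k => (hY k).snd.memLp_two
    rw [show (fun ω => L (Z₁ ω, Z₂ ω)) = fun ω => L (1, 0) * Z₁ ω + L (0, 1) * Z₂ ω from
      funext fun ω => hL _ _]
    refine hasGaussianLaw_of_tendsto_eLpNorm
      (Y := fun k ω => L (1, 0) * Y₁ k ω + L (0, 1) * Y₂ k ω) ?_ ?_ ?_ ?_
    · intro k
      have := (hY k).map_fun L
      rwa [show (fun ω => L (Y₁ k ω, Y₂ k ω)) = fun ω => L (1, 0) * Y₁ k ω + L (0, 1) * Y₂ k ω from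
        funext fun ω => hL _ _] at this
    · intro k
      rw [integral_add (((m₁ k).integrable (by norm_num)).const_mul _)
        (((m₂ k).integrable (by norm_num)).const_mul _), integral_const_mul, integral_const_mul,
        hY₁, hY₂]
      simp
    · exact (hZ₁.const_mul _).add (hZ₂.const_mul _)
    · have hb : ∀ k, eLpNorm (fun ω => L (1, 0) * Y₁ k ω + L (0, 1) * Y₂ k ω -
          (L (1, 0) * Z₁ ω + L (0, 1) * Z₂ ω)) 2 P ≤
          ‖L (1, 0)‖ₑ * eLpNorm (fun ω => Y₁ k ω - Z₁ ω) 2 P +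
          ‖L (0, 1)‖ₑ * eLpNorm (fun ω => Y₂ k ω - Z₂ ω) 2 P := by
        intro k
        have e : (fun ω => L (1, 0) * Y₁ k ω + L (0, 1) * Y₂ k ω -
          (L (1, 0) * Z₁ ω + L (0, 1) * Z₂ ω)) =
          (L (1, 0) • (fun ω => Y₁ k ω - Z₁ ω)) + (L (0, 1) • (fun ω => Y₂ k ω - Z₂ ω)) := by
          ext ω; simp; ring
        rw [e]
        refine (eLpNorm_add_le (((m₁ k).sub hZ₁).const_smul _).aestronglyMeasurable
          (((m₂ k).sub hZ₂).const_smul _).aestronglyMeasurable (by norm_num)).trans ?_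
        rw [eLpNorm_const_smul, eLpNorm_const_smul]
        exact le_rfl
      refine tendsto_of_tendsto_of_tendsto_of_le_of_le tendsto_const_nhds ?_ (fun _ => zero_le) hb
      have := (ENNReal.Tendsto.const_mul h₁ (Or.inr (enorm_ne_top (x := L (1, 0))))).add
        (ENNReal.Tendsto.const_mul h₂ (Or.inr (enorm_ne_top (x := L (0, 1)))))
      simpa using this
  refine ⟨⟨fun L => ?_⟩⟩
  have hg := hlin L
  have h1 := hg.map_eq_gaussianReal
  rw [AEMeasurable.map_map_of_aemeasurable L.continuous.measurable.aemeasurable hmeas,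
    integral_map hmeas L.continuous.aestronglyMeasurable,
    variance_map L.continuous.measurable.aemeasurable hmeas]
  exact h1

end Gaussian

/-! ### Absolute moments of Gaussian variables and their covariances. -/

/-- Mean value estimate for `|·|^p`. -/
theorem abs_abs_rpow_sub_abs_rpow_le {p : ℝ} (hp : 1 ≤ p) {y r M : ℝ} (hy : |y| ≤ M) (hr : |r| ≤ M) :
    |(|y| ^ p - |r| ^ p)| ≤ p * |y - r| * M ^ (p - 1) := by
  have hM : 0 ≤ M := (abs_nonneg y).trans hy
  have h := Convex.norm_image_sub_le_of_norm_hasDerivWithin_le (f := fun x : ℝ => x ^ p)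
    (f' := fun x => p * x ^ (p - 1)) (s := Icc 0 M) (C := p * M ^ (p - 1))
    (fun x _ => (Real.hasDerivAt_rpow_const (Or.inr hp)).hasDerivWithinAt)
    (fun x hx => by
      rw [Real.norm_eq_abs, abs_of_nonneg (mul_nonneg (by linarith) (Real.rpow_nonneg hx.1 _))]
      exact mul_le_mul_of_nonneg_left (Real.rpow_le_rpow hx.1 hx.2 (by linarith)) (by linarith)) (convex_Icc 0 M)
    (x := |r|) (y := |y|) ⟨abs_nonneg _, hr⟩ ⟨abs_nonneg _, hy⟩
  simp only [Real.norm_eq_abs] at h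
  refine h.trans ?_
  have h2 := abs_abs_sub_abs_le y r
  have : 0 ≤ M ^ (p - 1) := Real.rpow_nonneg hM _
  calc p * M ^ (p - 1) * |(|y| - |r|)| ≤ p * M ^ (p - 1) * |y - r| := by gcongr
    _ = _ := by ring

theorem normalAbsMoment_nonneg (p : ℝ) : 0 ≤ normalAbsMoment p :=
  integral_nonneg fun _ => Real.rpow_nonneg (abs_nonneg _) _

theorem add_rpow_le_two_rpow_mul {a b q : ℝ} (ha : 0 ≤ a) (hb : 0 ≤ b) (hq : 0 ≤ q) :
    (a + b) ^ q ≤ 2 ^ q * (a ^ q + b ^ q) := by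
  rcases le_total a b with h | h
  · calc (a + b) ^ q ≤ (2 * b) ^ q := by gcongr; linarith
      _ = 2 ^ q * b ^ q := Real.mul_rpow (by norm_num) hb
      _ ≤ _ := by gcongr; linarith [Real.rpow_nonneg ha q]
  · calc (a + b) ^ q ≤ (2 * a) ^ q := by gcongr; linarith
      _ = 2 ^ q * a ^ q := Real.mul_rpow (by norm_num) ha
      _ ≤ _ := by gcongr; linarith [Real.rpow_nonneg hb q]

section

variable {Ω : Type*} [MeasurableSpace Ω] {P : Measure Ω}

theorem integrable_abs_rpow {X : Ω → ℝ} (hX : HasGaussianLaw X P) {p : ℝ} (hp : 0 < p) :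
    Integrable (fun ω => |X ω| ^ p) P := by
  have h := (hX.memLp (p := ENNReal.ofReal p) (by simp)).integrable_norm_rpow
    (by simpa using hp) (by simp)
  simpa [ENNReal.toReal_ofReal hp.le] using h

theorem memLp_two_abs_rpow {X : Ω → ℝ} (hX : HasGaussianLaw X P) {p : ℝ} (hp : 0 < p) :
    MemLp (fun ω => |X ω| ^ p) 2 P := by
  have hm : AEStronglyMeasurable (fun ω => |X ω| ^ p) P :=
    (hX.aemeasurable.abs.pow_const p).aestronglyMeasurable
  rw [memLp_two_iff_integrable_sq hm]
  have h := integrable_abs_rpow hX (p := 2 * p) (by linarith)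
  refine h.congr (ae_of_all _ fun ω => ?_)
  dsimp only
  rw [mul_comm, Real.rpow_mul (abs_nonneg _), Real.rpow_two]

/-- Absolute moments of a centred Gaussian variable. -/
theorem integral_abs_rpow {X : Ω → ℝ} (hX : HasGaussianLaw X P) (hX0 : ∫ ω, X ω ∂P = 0) (p : ℝ) :
    ∫ ω, |X ω| ^ p ∂P = (∫ ω, X ω * X ω ∂P) ^ (p / 2) * normalAbsMoment p := by
  have hlaw := hX.map_eq_gaussianReal
  have hv : Var[X; P] = ∫ ω, X ω * X ω ∂P := by
    rw [variance_of_integral_eq_zero hX.aemeasurable hX0]; simp [pow_two]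
  set v := ∫ ω, X ω * X ω ∂P with hvdef
  have hv0 : 0 ≤ v := integral_nonneg fun ω => mul_self_nonneg _
  rw [hX0, hv] at hlaw
  have hmap := gaussianReal_map_const_mul (μ := 0) (v := 1) (√v)
  have hm : Measurable fun x : ℝ => |x| ^ p := by fun_prop
  have e : ∫ ω, |X ω| ^ p ∂P = ∫ x, |x| ^ p ∂(P.map X) :=
    (integral_map hX.aemeasurable hm.aestronglyMeasurable).symm
  have e2 : gaussianReal 0 v.toNNReal = (gaussianReal 0 1).map (√v * ·) := by
    rw [hmap, mul_zero]
    congr 1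
    ext
    simp [Real.sq_sqrt hv0, hv0]
  rw [e, hlaw, e2, integral_map (by fun_prop) hm.aestronglyMeasurable, normalAbsMoment,
    ← integral_const_mul]
  refine integral_congr_ae (ae_of_all _ fun x => ?_)
  dsimp only
  rw [abs_mul, abs_of_nonneg (Real.sqrt_nonneg _), Real.mul_rpow (Real.sqrt_nonneg _) (abs_nonneg _),
    Real.sqrt_eq_rpow, ← Real.rpow_mul hv0]
  ring_nf

/-- Moments of the envelope |X| + |Y|, used with q = p and q = 2p in the covariance bound.
Independence plays no role: convexity splits the power and each Gaussian moment scales as s^{q/2}.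
-/
theorem integral_add_abs_rpow_le {X Y : Ω → ℝ} (hX : HasGaussianLaw X P) (hY : HasGaussianLaw Y P)
    (hX0 : ∫ ω, X ω ∂P = 0) (hY0 : ∫ ω, Y ω ∂P = 0) {s q : ℝ} (hq : 0 < q)
    (hXs : ∫ ω, X ω * X ω ∂P ≤ s) (hYs : ∫ ω, Y ω * Y ω ∂P ≤ s) :
    Integrable (fun ω => (|X ω| + |Y ω|) ^ q) P ∧
    ∫ ω, (|X ω| + |Y ω|) ^ q ∂P ≤ 2 ^ (q + 1) * normalAbsMoment q * s ^ (q / 2) := by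
  have hi : Integrable (fun ω => 2 ^ q * (|X ω| ^ q + |Y ω| ^ q)) P :=
    ((integrable_abs_rpow hX hq).add (integrable_abs_rpow hY hq)).const_mul _
  have hle : ∀ ω, (|X ω| + |Y ω|) ^ q ≤ 2 ^ q * (|X ω| ^ q + |Y ω| ^ q) := fun ω =>
    add_rpow_le_two_rpow_mul (abs_nonneg _) (abs_nonneg _) hq.le
  have hint : Integrable (fun ω => (|X ω| + |Y ω|) ^ q) P := by
    refine hi.mono' ((hX.aemeasurable.abs.add hY.aemeasurable.abs).pow_const q).aestronglyMeasurable
      (ae_of_all _ fun ω => ?_)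
    rw [Real.norm_eq_abs, abs_of_nonneg (by positivity)]
    exact hle ω
  refine ⟨hint, (integral_mono hint hi hle).trans ?_⟩
  rw [integral_const_mul, integral_add (integrable_abs_rpow hX hq) (integrable_abs_rpow hY hq),
    integral_abs_rpow hX hX0, integral_abs_rpow hY hY0]
  have hM := normalAbsMoment_nonneg q
  have h1 : (∫ ω, X ω * X ω ∂P) ^ (q / 2) ≤ s ^ (q / 2) :=
    Real.rpow_le_rpow (integral_nonneg fun ω => mul_self_nonneg _) hXs (by linarith)
  have h2 : (∫ ω, Y ω * Y ω ∂P) ^ (q / 2) ≤ s ^ (q / 2) :=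
    Real.rpow_le_rpow (integral_nonneg fun ω => mul_self_nonneg _) hYs (by linarith)
  calc _ ≤ 2 ^ q * (s ^ (q / 2) * normalAbsMoment q + s ^ (q / 2) * normalAbsMoment q) := by gcongr
    _ = _ := by rw [Real.rpow_add (by norm_num), Real.rpow_one]; ring

/-- The constant of the covariance bound for absolute powers of Gaussian variables. -/
def covConst (p : ℝ) : ℝ :=
  p * (2 ^ (2 * p + 1) * normalAbsMoment (2 * p) + normalAbsMoment p * (2 ^ (p + 1) * normalAbsMoment p))

theorem covConst_nonneg {p : ℝ} (hp : 0 ≤ p) : 0 ≤ covConst p := by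
  have := normalAbsMoment_nonneg p
  have := normalAbsMoment_nonneg (2 * p)
  unfold covConst
  positivity

/-- Covariance bound for absolute powers of a centred Gaussian pair. -/
theorem abs_integral_abs_rpow_mul_sub_le {X Y : Ω → ℝ}
    (hXY : HasGaussianLaw (fun ω => (X ω, Y ω)) P)
    (hX0 : ∫ ω, X ω ∂P = 0) (hY0 : ∫ ω, Y ω ∂P = 0) {p s : ℝ} (hp : 1 ≤ p)
    (hXs : ∫ ω, X ω * X ω ∂P ≤ s) (hYs : ∫ ω, Y ω * Y ω ∂P ≤ s) :
    |∫ ω, |X ω| ^ p * |Y ω| ^ p ∂P - (∫ ω, |X ω| ^ p ∂P) * ∫ ω, |Y ω| ^ p ∂P| ≤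
      covConst p * s ^ (p - 1) * |∫ ω, X ω * Y ω ∂P| := by
  have hp0 : 0 < p := by linarith
  have := hXY.isProbabilityMeasure
  have hX := hXY.fst
  have hY := hXY.snd
  have hX2 := hX.memLp_two
  have hY2 := hY.memLp_two
  have iXX : Integrable (fun ω => X ω * X ω) P := hX2.integrable_mul hX2
  have iXY : Integrable (fun ω => X ω * Y ω) P := hX2.integrable_mul hY2
  have iYY : Integrable (fun ω => Y ω * Y ω) P := hY2.integrable_mul hY2
  set v := ∫ ω, X ω * X ω ∂P with hv
  set c := ∫ ω, X ω * Y ω ∂P with hc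
  have hv0 : 0 ≤ v := integral_nonneg fun ω => mul_self_nonneg _
  have hs0 : 0 ≤ s := hv0.trans hXs
  rcases hv0.eq_or_lt with hvz | hvpos
  -- The regression coefficient divides by the variance of X, so the degenerate case is treated
  -- apart.
  · have hX' : X =ᵐ[P] 0 := by
      have := (integral_eq_zero_iff_of_nonneg (fun ω => mul_self_nonneg (X ω))
        (hX2.integrable_mul hX2)).1 hvz.symm
      filter_upwards [this] with ω h
      simpa using h
    have e1 : ∫ ω, |X ω| ^ p * |Y ω| ^ p ∂P = 0 := by
      rw [integral_eq_zero_of_ae]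
      filter_upwards [hX'] with ω h
      simp [h, Real.zero_rpow hp0.ne']
    have e2 : ∫ ω, |X ω| ^ p ∂P = 0 := by
      rw [integral_eq_zero_of_ae]
      filter_upwards [hX'] with ω h
      simp [h, Real.zero_rpow hp0.ne']
    rw [e1, e2]
    have := covConst_nonneg hp0.le
    simp only [zero_mul, sub_self, abs_zero]
    positivity
  -- regression of `Y` on `X`
  set β := c / v with hβ
  set R : Ω → ℝ := fun ω => Y ω - β * X ω with hR
  have hXR : HasGaussianLaw (fun ω => (X ω, R ω)) P := by
    have := hXY.map_fun ((ContinuousLinearMap.fst ℝ ℝ ℝ).prod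
      (ContinuousLinearMap.snd ℝ ℝ ℝ - β • ContinuousLinearMap.fst ℝ ℝ ℝ))
    simpa using this
  have hRg := hXR.snd
  have hR0 : ∫ ω, R ω ∂P = 0 := by
    rw [hR, integral_sub (hY2.integrable (by norm_num))
      ((hX2.integrable (by norm_num)).const_mul _), integral_const_mul, hX0, hY0]; simp
  have hcovXR : cov[X, R; P] = 0 := by
    rw [covariance_eq_sub hX2 hRg.memLp_two]
    simp only [Pi.mul_apply, hX0, zero_mul, sub_zero]
    have : ∀ ω, X ω * R ω = X ω * Y ω - β * (X ω * X ω) := fun ω => by simp only [hR]; ring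
    simp_rw [this]
    rw [integral_sub iXY (iXX.const_mul _), integral_const_mul, ← hc, ← hv, hβ]
    field_simp
    ring
  have hind := hXR.indepFun_of_covariance_eq_zero hcovXR
  -- moments of the product with the independent part
  have hmf : Measurable fun x : ℝ => |x| ^ p := by fun_prop
  have hindp : ∫ ω, |X ω| ^ p * |R ω| ^ p ∂P = (∫ ω, |X ω| ^ p ∂P) * ∫ ω, |R ω| ^ p ∂P :=
    (hind.comp hmf hmf).integral_fun_mul_eq_mul_integral
      (integrable_abs_rpow hX hp0).aestronglyMeasurable
      (integrable_abs_rpow hRg hp0).aestronglyMeasurable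
  set D : Ω → ℝ := fun ω => |Y ω| ^ p - |R ω| ^ p with hD
  have hDi : Integrable D P := (integrable_abs_rpow hY hp0).sub (integrable_abs_rpow hRg hp0)
  have hfY : Integrable (fun ω => |X ω| ^ p * |Y ω| ^ p) P :=
    (memLp_two_abs_rpow hX hp0).integrable_mul (memLp_two_abs_rpow hY hp0)
  have hfR : Integrable (fun ω => |X ω| ^ p * |R ω| ^ p) P :=
    (memLp_two_abs_rpow hX hp0).integrable_mul (memLp_two_abs_rpow hRg hp0)
  -- The residual R is independent of X, so |R|^p contributes nothing to the covariance. Only D =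
  -- |Y|^p - |R|^p remains, and it is of first order in βX.
  have hid : ∫ ω, |X ω| ^ p * |Y ω| ^ p ∂P - (∫ ω, |X ω| ^ p ∂P) * ∫ ω, |Y ω| ^ p ∂P =
      ∫ ω, |X ω| ^ p * D ω ∂P - (∫ ω, |X ω| ^ p ∂P) * ∫ ω, D ω ∂P := by
    have e1 : ∫ ω, |X ω| ^ p * D ω ∂P =
        ∫ ω, |X ω| ^ p * |Y ω| ^ p ∂P - ∫ ω, |X ω| ^ p * |R ω| ^ p ∂P := by
      rw [← integral_sub hfY hfR]
      simp only [hD, mul_sub]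
    have e2 : ∫ ω, D ω ∂P = ∫ ω, |Y ω| ^ p ∂P - ∫ ω, |R ω| ^ p ∂P :=
      integral_sub (integrable_abs_rpow hY hp0) (integrable_abs_rpow hRg hp0)
    rw [e1, e2, hindp]; ring
  -- the scaled first variable
  have hc2 : c ^ 2 ≤ v * s := by
    have h0 : 0 ≤ ∫ ω, R ω * R ω ∂P := integral_nonneg fun ω => mul_self_nonneg _
    have : ∀ ω, R ω * R ω = Y ω * Y ω - 2 * β * (X ω * Y ω) + β ^ 2 * (X ω * X ω) :=
      fun ω => by simp only [hR]; ring
    simp_rw [this] at h0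
    have iD : Integrable (fun ω => Y ω * Y ω - 2 * β * (X ω * Y ω)) P := iYY.sub (iXY.const_mul _)
    rw [integral_add iD (iXX.const_mul _),
      integral_sub iYY (iXY.const_mul _), integral_const_mul, integral_const_mul,
      ← hc, ← hv, hβ] at h0
    have e : 2 * (c / v) * c - (c / v) ^ 2 * v = c ^ 2 / v := by field_simp; ring
    have : c ^ 2 / v ≤ s := by linarith
    rw [div_le_iff₀ hvpos] at this
    linarith
  -- The variance v of X may be far below s, which makes β large. Rescaling to X' = τX with variance
  -- s cures this: D costs a factor |c|τ/s, while |X|^p ≤ τ⁻¹|X'|^p because p ≥ 1, and τ cancels in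
  -- the product.
  set τ := √s / √v with hτ
  have hsv : 0 < √v := Real.sqrt_pos.2 hvpos
  have hspos : 0 < s := hvpos.trans_le hXs
  have hss : 0 < √s := Real.sqrt_pos.2 hspos
  have hτ1 : 1 ≤ τ := by
    rw [hτ, one_le_div hsv]; exact Real.sqrt_le_sqrt hXs
  set X' : Ω → ℝ := fun ω => τ * X ω with hX'
  have hX'g : HasGaussianLaw X' P := by simpa using hX.fun_smul τ
  have hX'0 : ∫ ω, X' ω ∂P = 0 := by rw [hX', integral_const_mul, hX0, mul_zero]
  have hX'v : ∫ ω, X' ω * X' ω ∂P ≤ s := by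
    have : ∀ ω, X' ω * X' ω = τ ^ 2 * (X ω * X ω) := fun ω => by simp only [hX']; ring
    simp_rw [this]
    rw [integral_const_mul, ← hv, hτ, div_pow, Real.sq_sqrt hs0, Real.sq_sqrt hv0]
    exact (by field_simp : s / v * v = s).le
  have hβτ : |β| ≤ τ := by
    have : |c| ≤ √(v * s) := Real.abs_le_sqrt hc2
    rw [hβ, abs_div, abs_of_pos hvpos, hτ, div_le_div_iff₀ hvpos hsv]
    calc |c| * √v ≤ √(v * s) * √v := by gcongr
      _ = √s * v := by
        rw [Real.sqrt_mul hv0]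
        calc √v * √s * √v = √s * (√v * √v) := by ring
          _ = _ := by rw [Real.mul_self_sqrt hv0]
  have hβX : ∀ ω, |β * X ω| ≤ |X' ω| := fun ω => by
    rw [hX', abs_mul, abs_mul, abs_of_pos (by linarith : 0 < τ)]; gcongr
  set B : Ω → ℝ := fun ω => |X' ω| + |Y ω| with hB
  have hB0 : ∀ ω, 0 ≤ B ω := fun ω => by positivity
  have hτ0 : 0 < τ := by linarith
  have hvτ : v * τ ^ 2 = s := by
    rw [hτ, div_pow, Real.sq_sqrt hs0, Real.sq_sqrt hv0]; field_simp
  have hβX2 : ∀ ω, |β * X ω| = |c| * τ / s * |X' ω| := fun ω => by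
    rw [hX', abs_mul, abs_mul, abs_of_pos hτ0, hβ, abs_div, abs_of_pos hvpos, ← hvτ]
    field_simp
  have hDb : ∀ ω, |D ω| ≤ p * (|c| * τ / s) * B ω ^ p := by
    intro ω
    have h := abs_abs_rpow_sub_abs_rpow_le hp (y := Y ω) (r := R ω) (M := B ω)
      (by simp only [hB]; linarith [abs_nonneg (X' ω)])
      (by
        have := abs_sub (Y ω) (β * X ω)
        simp only [hB, hR]; linarith [hβX ω])
    rw [show Y ω - R ω = β * X ω by simp only [hR]; ring, hβX2] at h
    refine h.trans ?_
    have e : B ω ^ p = B ω * B ω ^ (p - 1) := by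
      rw [← Real.rpow_one_add' (hB0 ω) (by linarith)]; congr 1; ring
    rw [e]
    have h1 : |X' ω| ≤ B ω := by simp only [hB]; linarith [abs_nonneg (Y ω)]
    have h2 : 0 ≤ B ω ^ (p - 1) := Real.rpow_nonneg (hB0 ω) _
    calc p * (|c| * τ / s * |X' ω|) * B ω ^ (p - 1) ≤ p * (|c| * τ / s * B ω) * B ω ^ (p - 1) := by
          gcongr
      _ = _ := by ring
  have hXp : ∀ ω, |X ω| ^ p ≤ τ⁻¹ * |X' ω| ^ p := fun ω => by
    have e : |X' ω| ^ p = τ ^ p * |X ω| ^ p := by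
      rw [hX', abs_mul, abs_of_pos hτ0, Real.mul_rpow hτ0.le (abs_nonneg _)]
    have h1 : τ ≤ τ ^ p := by simpa using Real.rpow_le_rpow_of_exponent_le hτ1 hp
    rw [e, ← mul_assoc]
    refine le_mul_of_one_le_left (Real.rpow_nonneg (abs_nonneg _) _) ?_
    rw [inv_mul_eq_div, one_le_div hτ0]
    exact h1
  obtain ⟨iBp, hBp⟩ := integral_add_abs_rpow_le hX'g hY hX'0 hY0 hp0 hX'v hYs
  obtain ⟨iB2p, hB2p⟩ := integral_add_abs_rpow_le hX'g hY hX'0 hY0 (q := 2 * p) (by linarith) hX'v hYs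
  have hXpos : ∀ ω, 0 ≤ |X ω| ^ p := fun ω => Real.rpow_nonneg (abs_nonneg _) _
  have hM := normalAbsMoment_nonneg p
  have hfirst : |∫ ω, |X ω| ^ p * D ω ∂P| ≤
      p * (|c| / s) * (2 ^ (2 * p + 1) * normalAbsMoment (2 * p) * s ^ (2 * p / 2)) := by
    refine (abs_integral_le_integral_abs).trans (le_trans ?_
      (mul_le_mul_of_nonneg_left hB2p (by positivity : 0 ≤ p * (|c| / s))))
    rw [← integral_const_mul]
    refine integral_mono_of_nonneg (ae_of_all _ fun ω => abs_nonneg _) (iB2p.const_mul _)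
      (ae_of_all _ fun ω => ?_)
    dsimp only
    rw [abs_mul, abs_of_nonneg (hXpos ω)]
    have h1 : |X' ω| ^ p ≤ B ω ^ p := Real.rpow_le_rpow (abs_nonneg _)
      (by simp only [hB]; linarith [abs_nonneg (Y ω)]) hp0.le
    have h2 : B ω ^ (2 * p) = B ω ^ p * B ω ^ p := by
      rw [two_mul, Real.rpow_add_of_nonneg (hB0 ω) hp0.le hp0.le]
    have h3 : 0 ≤ B ω ^ p := Real.rpow_nonneg (hB0 ω) _
    calc |X ω| ^ p * |D ω| ≤ (τ⁻¹ * |X' ω| ^ p) * (p * (|c| * τ / s) * B ω ^ p) := by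
          gcongr
          · exact hXp ω
          · exact hDb ω
      _ ≤ (τ⁻¹ * B ω ^ p) * (p * (|c| * τ / s) * B ω ^ p) := by gcongr
      _ = p * (|c| / s) * B ω ^ (2 * p) := by rw [h2]; field_simp
  have hsecond : |(∫ ω, |X ω| ^ p ∂P) * ∫ ω, D ω ∂P| ≤
      p * (|c| / s) * (normalAbsMoment p * s ^ (p / 2)) *
        (2 ^ (p + 1) * normalAbsMoment p * s ^ (p / 2)) := by
    have h1 : ∫ ω, |X ω| ^ p ∂P ≤ τ⁻¹ * (normalAbsMoment p * s ^ (p / 2)) := by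
      refine (integral_mono (integrable_abs_rpow hX hp0)
        ((integrable_abs_rpow hX'g hp0).const_mul _) hXp).trans ?_
      rw [integral_const_mul, integral_abs_rpow hX'g hX'0, mul_comm (normalAbsMoment p)]
      gcongr
      exact integral_nonneg fun ω => mul_self_nonneg _
    have h2 : |∫ ω, D ω ∂P| ≤
        p * (|c| * τ / s) * (2 ^ (p + 1) * normalAbsMoment p * s ^ (p / 2)) := by
      refine (abs_integral_le_integral_abs).trans (le_trans ?_
        (mul_le_mul_of_nonneg_left hBp (by positivity : 0 ≤ p * (|c| * τ / s))))
      rw [← integral_const_mul]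
      exact integral_mono_of_nonneg (ae_of_all _ fun ω => abs_nonneg _) (iBp.const_mul _)
        (ae_of_all _ hDb)
    rw [abs_mul, abs_of_nonneg (integral_nonneg hXpos)]
    calc _ ≤ (τ⁻¹ * (normalAbsMoment p * s ^ (p / 2))) *
          (p * (|c| * τ / s) * (2 ^ (p + 1) * normalAbsMoment p * s ^ (p / 2))) := by
          gcongr
      _ = _ := by field_simp
  rw [hid]
  refine (abs_sub _ _).trans ((add_le_add hfirst hsecond).trans (le_of_eq ?_))
  have e1 : s ^ (2 * p / 2) = s ^ (p - 1) * s := by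
    rw [← Real.rpow_add_one' hs0 (by linarith)]; congr 1; ring
  have e2 : s ^ (p / 2) * s ^ (p / 2) = s ^ (p - 1) * s := by
    rw [← Real.rpow_add hspos, ← Real.rpow_add_one' hs0 (by linarith)]; congr 1; ring
  calc _ = p * (|c| / s) * (2 ^ (2 * p + 1) * normalAbsMoment (2 * p) * s ^ (2 * p / 2)) +
        p * (|c| / s) * (normalAbsMoment p * (2 ^ (p + 1) * normalAbsMoment p)) *
        (s ^ (p / 2) * s ^ (p / 2)) := by ring
    _ = _ := by rw [e1, e2, covConst]; field_simp

end

/-! ### Almost sure convergence from summable variances. -/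

section

variable {Ω : Type*} [MeasurableSpace Ω] {P : Measure Ω} [IsProbabilityMeasure P]

/-- Summable variances and convergent means give almost sure convergence. -/
theorem ae_tendsto_of_summable_variance {S : ℕ → Ω → ℝ} {L : ℝ} (hS : ∀ n, MemLp (S n) 2 P)
    (hvar : Summable fun n => Var[S n; P]) (hmean : Tendsto (fun n => ∫ ω, S n ω ∂P) atTop (𝓝 L)) :
    ∀ᵐ ω ∂P, Tendsto (fun n => S n ω) atTop (𝓝 L) := by
  -- By Tonelli the sum of squared deviations has finite expectation. It is thus almost surely
  -- finite and its terms tend to 0.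
  have h1 : ∫⁻ ω, ∑' n, ENNReal.ofReal ((S n ω - P[S n]) ^ 2) ∂P ≠ ∞ := by
    rw [lintegral_tsum]
    · have : ∀ n, ∫⁻ ω, ENNReal.ofReal ((S n ω - P[S n]) ^ 2) ∂P = ENNReal.ofReal Var[S n; P] := by
        intro n
        rw [← evariance_eq_lintegral_ofReal, (hS n).ofReal_variance_eq]
      simp_rw [this]
      exact hvar.tsum_ofReal_ne_top
    · intro n
      have := (hS n).aestronglyMeasurable.aemeasurable
      fun_prop
  have h2 := ae_lt_top' (by
    refine AEMeasurable.tsum fun n => ?_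
    have := (hS n).aestronglyMeasurable.aemeasurable
    fun_prop) h1
  filter_upwards [h2] with ω hω
  have h3 : Tendsto (fun n => ENNReal.ofReal ((S n ω - P[S n]) ^ 2)) atTop (𝓝 0) := by
    rw [← Nat.cofinite_eq_atTop]
    exact ENNReal.tendsto_cofinite_zero_of_tsum_ne_top hω.ne
  have h4 : Tendsto (fun n => (S n ω - P[S n]) ^ 2) atTop (𝓝 0) := by
    have := (ENNReal.tendsto_toReal ENNReal.zero_ne_top).comp h3
    refine this.congr fun n => ?_
    simp [ENNReal.toReal_ofReal (sq_nonneg _)]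
  have h5 : Tendsto (fun n => S n ω - P[S n]) atTop (𝓝 0) := by
    have := (Real.continuous_sqrt.tendsto _).comp h4
    rw [Real.sqrt_zero] at this
    rw [tendsto_zero_iff_abs_tendsto_zero]
    refine this.congr fun n => ?_
    simp [Real.sqrt_sq_eq_abs]
  simpa using h5.add hmean

/-- Almost sure convergence of power variations of Gaussian arrays. -/
theorem ae_tendsto_sum_abs_rpow {X : ℕ → ℤ → Ω → ℝ} {I : ℕ → Finset ℤ} {p L : ℝ} {s : ℕ → ℝ}
    (hp : 1 ≤ p)
    (hG : ∀ n, ∀ i ∈ I n, ∀ j ∈ I n, HasGaussianLaw (fun ω => (X n i ω, X n j ω)) P)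
    (h0 : ∀ n, ∀ i ∈ I n, ∫ ω, X n i ω ∂P = 0)
    (hs : ∀ n, ∀ i ∈ I n, ∫ ω, X n i ω * X n i ω ∂P ≤ s n)
    (hsum : Summable fun n => s n ^ (p - 1) * ∑ i ∈ I n, ∑ j ∈ I n, |∫ ω, X n i ω * X n j ω ∂P|)
    (hmean : Tendsto (fun n => ∑ i ∈ I n, (∫ ω, X n i ω * X n i ω ∂P) ^ (p / 2)) atTop (𝓝 L)) :
    ∀ᵐ ω ∂P, Tendsto (fun n => ∑ i ∈ I n, |X n i ω| ^ p) atTop (𝓝 (L * normalAbsMoment p)) := by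
  have hp0 : 0 < p := by linarith
  have hm : ∀ n, ∀ i ∈ I n, MemLp (fun ω => |X n i ω| ^ p) 2 P := fun n i hi =>
    memLp_two_abs_rpow (hG n i hi i hi).fst hp0
  refine ae_tendsto_of_summable_variance (fun n => memLp_finsetSum _ (hm n)) ?_ ?_
  · refine Summable.of_nonneg_of_le (fun n => variance_nonneg _ _) (fun n => ?_)
      (hsum.mul_left (covConst p))
    rw [variance_fun_sum' (hm n), mul_left_comm, Finset.mul_sum, Finset.mul_sum]
    refine Finset.sum_le_sum fun i hi => ?_
    rw [Finset.mul_sum, Finset.mul_sum]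
    refine Finset.sum_le_sum fun j hj => ?_
    rw [covariance_eq_sub (hm n i hi) (hm n j hj)]
    refine (le_abs_self _).trans ((abs_integral_abs_rpow_mul_sub_le (hG n i hi j hj) (h0 n i hi)
      (h0 n j hj) hp (hs n i hi) (hs n j hj)).trans (le_of_eq ?_))
    ring
  · have : ∀ n, ∫ ω, ∑ i ∈ I n, |X n i ω| ^ p ∂P =
        (∑ i ∈ I n, (∫ ω, X n i ω * X n i ω ∂P) ^ (p / 2)) * normalAbsMoment p := by
      intro n
      rw [integral_finsetSum _ fun i hi => (hm n i hi).integrable (by norm_num), Finset.sum_mul]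
      exact Finset.sum_congr rfl fun i hi =>
        integral_abs_rpow (hG n i hi i hi).fst (h0 n i hi) p
    simp_rw [this]
    exact hmean.mul_const _

end

/-! ### Wiener integrals: isometry and joint Gaussianity. -/

theorem stronglyMeasurable_spaceFourier (φ : TestFun) : StronglyMeasurable (spaceFourier φ) := by
  have hc : Continuous fun w : (ℝ × ℝ) × ℝ =>
      Complex.exp (-(Complex.I * (w.1.2 : ℂ) * (w.2 : ℂ))) * ((φ (w.1.1, w.2) : ℝ) : ℂ) := by
    have : Continuous (φ : ℝ × ℝ → ℝ) := φ.contDiff.continuous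
    fun_prop
  exact hc.stronglyMeasurable.integral_prod_right (ν := volume)

theorem tendsto_eLpNorm_sub_sub {Ω : Type*} [MeasurableSpace Ω] {P : Measure Ω} {Y₁ Y₂ : ℕ → Ω → ℝ} {Z₁ Z₂ : Ω → ℝ} (hY₁ : ∀ k, MemLp (Y₁ k) 2 P)
    (hY₂ : ∀ k, MemLp (Y₂ k) 2 P) (hZ₁ : MemLp Z₁ 2 P) (hZ₂ : MemLp Z₂ 2 P)
    (h₁ : Tendsto (fun k => eLpNorm (fun ω => Y₁ k ω - Z₁ ω) 2 P) atTop (𝓝 0))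
    (h₂ : Tendsto (fun k => eLpNorm (fun ω => Y₂ k ω - Z₂ ω) 2 P) atTop (𝓝 0)) :
    Tendsto (fun k => eLpNorm (fun ω => (Y₁ k ω - Y₂ k ω) - (Z₁ ω - Z₂ ω)) 2 P) atTop (𝓝 0) := by
  refine tendsto_of_tendsto_of_tendsto_of_le_of_le tendsto_const_nhds (by simpa using h₁.add h₂)
    (fun _ => zero_le) fun k => ?_
  have e : (fun ω => (Y₁ k ω - Y₂ k ω) - (Z₁ ω - Z₂ ω)) =
      (fun ω => Y₁ k ω - Z₁ ω) - fun ω => Y₂ k ω - Z₂ ω := by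
    ext ω; simp; ring
  rw [e]
  exact eLpNorm_sub_le ((hY₁ k).sub hZ₁).aestronglyMeasurable
    ((hY₂ k).sub hZ₂).aestronglyMeasurable (by norm_num)

/-- A Wiener integral of an integrand of finite norm is approximated by test functions of finite
norm. -/
theorem IsWienerIntegral.exists_approx_memLp {Ω : Type*} [MeasurableSpace Ω]
    {P : Measure Ω} {H : ℝ} {W : TestFun → Ω → ℝ} {g : ℝ × ℝ → ℝ} {I : Ω → ℝ}
    (hI : IsWienerIntegral H P W g I) (hg : MemLp (spaceFourier g) 2 (spectralMeasure H)) :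
    ∃ φ : ℕ → TestFun, (∀ k, MemLp (spaceFourier (φ k)) 2 (spectralMeasure H)) ∧
      Tendsto (fun k => eLpNorm (fun z => spaceFourier (φ k) z - spaceFourier g z) 2
        (spectralMeasure H)) atTop (𝓝 0) ∧
      Tendsto (fun k => eLpNorm (fun ω => W (φ k) ω - I ω) 2 P) atTop (𝓝 0) := by
  obtain ⟨φ, h1, h2⟩ := hI.exists_approx
  have hev : ∀ᶠ k in atTop, eLpNorm (fun z => spaceFourier (φ k) z - spaceFourier g z) 2
      (spectralMeasure H) < 1 := h1.eventually_lt_const (by norm_num)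
  obtain ⟨N, hN⟩ := eventually_atTop.1 hev
  -- Convergence allows finitely many approximants at infinite distance from g. Past N the distance
  -- is below 1, so the test function inherits finite norm from g.
  refine ⟨fun k => φ (k + N), fun k => ?_, h1.comp (tendsto_add_atTop_nat N),
    h2.comp (tendsto_add_atTop_nat N)⟩
  have hd : MemLp (fun z => spaceFourier (φ (k + N)) z - spaceFourier g z) 2 (spectralMeasure H) :=
    ⟨(stronglyMeasurable_spaceFourier _).aestronglyMeasurable.sub hg.aestronglyMeasurable,
      (hN (k + N) (by omega)).trans (by norm_num)⟩
  have := hd.add hg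
  refine this.congr_norm (stronglyMeasurable_spaceFourier _).aestronglyMeasurable
    (ae_of_all _ fun z => ?_)
  simp

section

variable {Ω : Type*} [MeasurableSpace Ω] {P : Measure Ω} {H : ℝ}
  {W : TestFun → Ω → ℝ}

/-- Isometry of the Wiener integral. -/
theorem IsFractionalNoise.integral_mul_eq (hW : IsFractionalNoise H P W) {g₁ g₂ : ℝ × ℝ → ℝ}
    {I₁ I₂ : Ω → ℝ} (h₁ : IsWienerIntegral H P W g₁ I₁) (h₂ : IsWienerIntegral H P W g₂ I₂)
    (hg₁ : MemLp (spaceFourier g₁) 2 (spectralMeasure H))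
    (hg₂ : MemLp (spaceFourier g₂) 2 (spectralMeasure H)) :
    ((∫ ω, I₁ ω * I₂ ω ∂P : ℝ) : ℂ) =
      ∫ z, spaceFourier g₁ z * (starRingEnd ℂ) (spaceFourier g₂ z) ∂(spectralMeasure H) := by
  obtain ⟨φ, hφ, hφF, hφW⟩ := h₁.exists_approx_memLp hg₁
  obtain ⟨ψ, hψ, hψF, hψW⟩ := h₂.exists_approx_memLp hg₂
  have hL : ∀ φ, MemLp (W φ) 2 P := fun φ => (hW.gaussian.hasGaussianLaw_eval φ).memLp_two
  have hP := tendsto_integral_mul_of_tendsto_eLpNorm h₁.memLp h₂.memLp (fun k => hL (φ k))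
    (fun k => hL (ψ k)) hφW hψW
  have hF := tendsto_integral_mul_conj hg₁ hg₂ hφ hψ hφF hψF
  refine tendsto_nhds_unique ((Complex.continuous_ofReal.tendsto _).comp hP) ?_
  refine hF.congr fun k => ?_
  exact (hW.covariance _ _).symm

theorem IsFractionalNoise.integral_eq_zero [IsProbabilityMeasure P]
    (hW : IsFractionalNoise H P W) {g : ℝ × ℝ → ℝ}
    {I : Ω → ℝ} (h : IsWienerIntegral H P W g I) : ∫ ω, I ω ∂P = 0 := by
  obtain ⟨φ, -, hφ⟩ := h.exists_approx
  exact integral_eq_zero_of_tendsto_eLpNorm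
    (fun k => (hW.gaussian.hasGaussianLaw_eval (φ k)).memLp_two) (fun k => hW.mean_zero _)
    h.memLp hφ

/-- Differences of Wiener integrals are jointly Gaussian. -/
theorem IsFractionalNoise.hasGaussianLaw_sub_prodMk [IsProbabilityMeasure P]
    (hW : IsFractionalNoise H P W)
    {g₁ g₂ g₃ g₄ : ℝ × ℝ → ℝ} {I₁ I₂ I₃ I₄ : Ω → ℝ} (h₁ : IsWienerIntegral H P W g₁ I₁)
    (h₂ : IsWienerIntegral H P W g₂ I₂) (h₃ : IsWienerIntegral H P W g₃ I₃)
    (h₄ : IsWienerIntegral H P W g₄ I₄) :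
    HasGaussianLaw (fun ω => (I₁ ω - I₂ ω, I₃ ω - I₄ ω)) P := by
  obtain ⟨φ₁, -, a₁⟩ := h₁.exists_approx
  obtain ⟨φ₂, -, a₂⟩ := h₂.exists_approx
  obtain ⟨φ₃, -, a₃⟩ := h₃.exists_approx
  obtain ⟨φ₄, -, a₄⟩ := h₄.exists_approx
  have hL : ∀ φ, MemLp (W φ) 2 P := fun φ => (hW.gaussian.hasGaussianLaw_eval φ).memLp_two
  have hproc : IsGaussianProcess (fun (q : TestFun × TestFun) ω => W q.1 ω - W q.2 ω) P := by
    classical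
    refine IsGaussianProcess.of_isGaussianProcess hW.gaussian fun q => ?_
    refine ⟨{q.1, q.2}, ContinuousLinearMap.proj (R := ℝ) (φ := fun _ => ℝ)
      (⟨q.1, by simp⟩ : ({q.1, q.2} : Finset TestFun)) -
      ContinuousLinearMap.proj (R := ℝ) (φ := fun _ => ℝ)
      (⟨q.2, by simp⟩ : ({q.1, q.2} : Finset TestFun)), fun ω => ?_⟩
    simp
  have hmean : ∀ φ ψ, ∫ ω, W φ ω - W ψ ω ∂P = 0 := fun φ ψ => by
    rw [integral_sub ((hL φ).integrable (by norm_num)) ((hL ψ).integrable (by norm_num)),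
      hW.mean_zero, hW.mean_zero, sub_zero]
  exact hasGaussianLaw_prodMk_of_tendsto_eLpNorm
    (Y₁ := fun k ω => W (φ₁ k) ω - W (φ₂ k) ω) (Y₂ := fun k ω => W (φ₃ k) ω - W (φ₄ k) ω)
    (fun k => hproc.hasGaussianLaw_prodMk (s := (φ₁ k, φ₂ k)) (t := (φ₃ k, φ₄ k)))
    (fun k => hmean _ _) (fun k => hmean _ _) (h₁.memLp.sub h₂.memLp) (h₃.memLp.sub h₄.memLp)
    (tendsto_eLpNorm_sub_sub (fun _ => hL _) (fun _ => hL _) h₁.memLp h₂.memLp a₁ a₂)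
    (tendsto_eLpNorm_sub_sub (fun _ => hL _) (fun _ => hL _) h₃.memLp h₄.memLp a₃ a₄)

end

/-! ### Spectral integrals of the heat kernel. -/

/-- Fourier transform of the heat kernel integrand. -/
theorem spaceFourier_convKernel {κ : ℝ} (hκ : 0 < κ) (t x : ℝ) (z : ℝ × ℝ) :
    spaceFourier (convKernel κ t x) z =
      if 0 < z.1 ∧ z.1 < t then Complex.exp (-(Complex.I * z.2 * x)) *
        Complex.exp ((-(κ * (t - z.1) * z.2 ^ 2 / 2) : ℝ) : ℂ) else 0 := by
  obtain ⟨s, ξ⟩ := z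
  simp only [spaceFourier, convKernel]
  split_ifs with h
  swap
  · simp
  have hr : 0 < t - s := by linarith [h.2]
  set r := t - s with hrdef
  have hb : 0 < ((1 / (2 * κ * r) : ℝ) : ℂ).re := by
    rw [Complex.ofReal_re]; positivity
  have hF := fourierIntegral_gaussian hb (ξ : ℂ)
  have hsub := integral_sub_left_eq_self (fun y : ℝ => Complex.exp (Complex.I * ξ * y) *
    Complex.exp (-((1 / (2 * κ * r) : ℝ) : ℂ) * (y : ℂ) ^ 2)) volume x
  rw [hF] at hsub
  have hpt : ∀ y : ℝ, Complex.exp (-(Complex.I * ξ * y)) * ((heatKernel κ r (x - y) : ℝ) : ℂ) =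
      (1 / Real.sqrt (2 * Real.pi * κ * r) : ℝ) * Complex.exp (-(Complex.I * ξ * x)) *
      (Complex.exp (Complex.I * ξ * ((x - y : ℝ) : ℂ)) *
        Complex.exp (-((1 / (2 * κ * r) : ℝ) : ℂ) * ((x - y : ℝ) : ℂ) ^ 2)) := by
    intro y
    have e : Complex.exp (-(Complex.I * ξ * y)) = Complex.exp (-(Complex.I * ξ * x)) *
        Complex.exp (Complex.I * ξ * ((x - y : ℝ) : ℂ)) := by
      rw [← Complex.exp_add]; congr 1; push_cast; ring
    rw [e, heatKernel, Complex.ofReal_mul, Complex.ofReal_exp]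
    have e2 : ((-((x - y) ^ 2 / (2 * κ * r)) : ℝ) : ℂ) =
        -((1 / (2 * κ * r) : ℝ) : ℂ) * ((x - y : ℝ) : ℂ) ^ 2 := by
      push_cast; ring
    rw [e2]; ring
  simp_rw [hpt]
  rw [integral_const_mul, hsub]
  have e3 : ((Real.pi : ℂ) / ((1 / (2 * κ * r) : ℝ) : ℂ)) ^ (1 / 2 : ℂ) =
      (Real.sqrt (2 * Real.pi * κ * r) : ℝ) := by
    rw [← Complex.ofReal_div, show (1 / 2 : ℂ) = ((1 / 2 : ℝ) : ℂ) by push_cast; rfl,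
      ← Complex.ofReal_cpow (by positivity), Real.sqrt_eq_rpow]
    congr 2
    field_simp
  rw [e3]
  have hne : ((Real.sqrt (2 * Real.pi * κ * r) : ℝ) : ℂ) ≠ 0 := by
    rw [Complex.ofReal_ne_zero]; positivity
  have e4 : -(ξ : ℂ) ^ 2 / (4 * ((1 / (2 * κ * r) : ℝ) : ℂ)) =
      ((-(κ * r * ξ ^ 2 / 2) : ℝ) : ℂ) := by
    have : (κ : ℂ) ≠ 0 := by exact_mod_cast hκ.ne'
    have : (r : ℂ) ≠ 0 := by exact_mod_cast hr.ne'
    push_cast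
    field_simp
    ring
  rw [e4]
  push_cast
  field_simp

/-- Absolute Gaussian moments on the line. -/
theorem integral_abs_rpow_mul_exp {b q : ℝ} (hb : 0 < b) (hq : -1 < q) :
    ∫ ξ : ℝ, |ξ| ^ q * Real.exp (-(b * ξ ^ 2)) = b ^ (-(q + 1) / 2) * Real.Gamma ((q + 1) / 2) := by
  have h := integral_comp_abs (f := fun ξ : ℝ => ξ ^ q * Real.exp (-b * ξ ^ (2 : ℝ)))
  rw [integral_rpow_mul_exp_neg_mul_rpow (by norm_num) hq hb] at h
  have e : ∀ ξ : ℝ, |ξ| ^ q * Real.exp (-(b * ξ ^ 2)) =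
      |ξ| ^ q * Real.exp (-b * |ξ| ^ (2 : ℝ)) := by
    intro ξ
    rw [Real.rpow_two, sq_abs, neg_mul]
  simp_rw [e]
  rw [h]; ring

theorem integrable_abs_rpow_mul_exp {b q : ℝ} (hb : 0 < b) (hq : -1 < q) :
    Integrable fun ξ : ℝ => |ξ| ^ q * Real.exp (-(b * ξ ^ 2)) := by
  -- The integral of a non-integrable function is 0 by default, so a nonzero value proves
  -- integrability.
  refine not_imp_comm.1 integral_undef ?_
  rw [integral_abs_rpow_mul_exp hb hq]
  have := Real.Gamma_pos_of_pos (s := (q + 1) / 2) (by linarith)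
  positivity

theorem noiseConst_pos {H : ℝ} (hH0 : 0 < H) (hH1 : H < 1) : 0 < noiseConst H := by
  have h1 := Real.Gamma_pos_of_pos (s := 2 * H + 1) (by linarith)
  have h2 : 0 < Real.sin (H * Real.pi) :=
    Real.sin_pos_of_pos_of_lt_pi (by positivity) (by nlinarith [Real.pi_pos])
  unfold noiseConst
  positivity

theorem integrable_spectralMeasure_iff {H : ℝ} (hH0 : 0 < H) (hH1 : H < 1) {E : Type*} [NormedAddCommGroup E] [NormedSpace ℝ E]
    {f : ℝ × ℝ → E} :
    Integrable f (spectralMeasure H) ↔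
      Integrable (fun z : ℝ × ℝ => (noiseConst H * |z.2| ^ (1 - 2 * H)) • f z)
        ((volume.restrict (Ioi 0)).prod volume) := by
  have hc := noiseConst_pos hH0 hH1
  rw [spectralMeasure, integrable_withDensity_iff_integrable_smul' (by fun_prop)
    (ae_of_all _ fun _ => ENNReal.ofReal_lt_top), Measure.volume_eq_prod, ← Measure.prod_restrict,
    Measure.restrict_univ]
  refine integrable_congr (ae_of_all _ fun z => ?_)
  dsimp only
  rw [ENNReal.toReal_ofReal (by positivity)]

theorem integral_spectralMeasure {H : ℝ} (hH0 : 0 < H) (hH1 : H < 1) (f : ℝ × ℝ → ℝ) :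
    ∫ z, f z ∂(spectralMeasure H) =
      ∫ z, noiseConst H * |z.2| ^ (1 - 2 * H) * f z ∂((volume.restrict (Ioi 0)).prod volume) := by
  have hc := noiseConst_pos hH0 hH1
  rw [spectralMeasure, integral_withDensity_eq_integral_toReal_smul (by fun_prop)
    (ae_of_all _ fun _ => ENNReal.ofReal_lt_top), Measure.volume_eq_prod, ← Measure.prod_restrict,
    Measure.restrict_univ]
  refine integral_congr_ae (ae_of_all _ fun z => ?_)
  dsimp only
  rw [ENNReal.toReal_ofReal (by positivity), smul_eq_mul]

theorem integrableOn_sub_rpow {H a m : ℝ} (hH0 : 0 < H) (hm0 : 0 ≤ m) :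
    IntegrableOn (fun r : ℝ => (a - r) ^ (H - 1)) (Ioo 0 m) := by
  have h : IntervalIntegrable (fun r : ℝ => (a - r) ^ (H - 1)) volume 0 m := by
    have := (intervalIntegral.intervalIntegrable_rpow' (a := a - 0) (b := a - m) (r := H - 1)
      (by linarith)).comp_sub_left a
    simpa using this
  exact ((intervalIntegrable_iff_integrableOn_Ioc_of_le hm0).1 h).mono_set Ioo_subset_Ioc_self

theorem integral_sub_rpow {H a m : ℝ} (hH0 : 0 < H) (hm0 : 0 ≤ m) :
    ∫ r in Ioo 0 m, (a - r) ^ (H - 1) = (a ^ H - (a - m) ^ H) / H := by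
  rw [← integral_Ioc_eq_integral_Ioo, ← intervalIntegral.integral_of_le hm0,
    intervalIntegral.integral_comp_sub_left (fun x => x ^ (H - 1)) a,
    integral_rpow (Or.inl (by linarith))]
  simp

/-- The product of the Fourier transforms of two heat kernel integrands, up to the phase. -/
def heatCov (κ t s d : ℝ) (z : ℝ × ℝ) : ℝ :=
  if 0 < z.1 ∧ z.1 < min t s then
    Real.cos (z.2 * d) * Real.exp (-(κ * ((t + s) / 2 - z.1) * z.2 ^ 2)) else 0

theorem measurable_heatCov (κ t s d : ℝ) : Measurable (heatCov κ t s d) := by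
  unfold heatCov
  refine Measurable.ite ?_ (by fun_prop) measurable_const
  exact (measurableSet_lt measurable_const measurable_fst).inter
    (measurableSet_lt measurable_fst measurable_const)

theorem abs_heatCov_le (κ t s d : ℝ) (z : ℝ × ℝ) : |heatCov κ t s d z| ≤ heatCov κ t s 0 z := by
  unfold heatCov
  split_ifs with h
  · rw [abs_mul, abs_of_pos (Real.exp_pos _), mul_zero, Real.cos_zero]
    gcongr
    exact Real.abs_cos_le_one _
  · simp

theorem weight_mul_heatCov_zero (H κ t s r ξ : ℝ) :
    noiseConst H * |ξ| ^ (1 - 2 * H) * heatCov κ t s 0 (r, ξ) =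
      (if 0 < r ∧ r < min t s then noiseConst H else 0) *
        (|ξ| ^ (1 - 2 * H) * Real.exp (-(κ * ((t + s) / 2 - r) * ξ ^ 2))) := by
  unfold heatCov
  split_ifs
  · simp [mul_assoc]
  · simp

theorem integral_weight_mul_heatCov_zero {H κ : ℝ} (hH1 : H < 1) (hκ : 0 < κ)
    {t s r : ℝ} (hr : 0 < r) :
    ∫ ξ, noiseConst H * |ξ| ^ (1 - 2 * H) * heatCov κ t s 0 (r, ξ) =
      (Ioo 0 (min t s)).indicator (fun r => noiseConst H * Real.Gamma (1 - H) * κ ^ (H - 1) *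
        ((t + s) / 2 - r) ^ (H - 1)) r := by
  simp_rw [weight_mul_heatCov_zero]
  rw [integral_const_mul]
  by_cases h : r < min t s
  · have hpos : 0 < (t + s) / 2 - r := by
      have := h.trans_le (min_le_left _ _); have := h.trans_le (min_le_right _ _); linarith
    rw [if_pos ⟨hr, h⟩, indicator_of_mem (show r ∈ Ioo 0 (min t s) from ⟨hr, h⟩), integral_abs_rpow_mul_exp (by positivity)
      (by linarith), Real.mul_rpow hκ.le hpos.le,
      show -(1 - 2 * H + 1) / 2 = H - 1 by ring, show (1 - 2 * H + 1) / 2 = 1 - H by ring]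
    ring
  · rw [if_neg (fun h' => h h'.2), indicator_of_notMem (fun h' : r ∈ Ioo 0 (min t s) => h h'.2), zero_mul]

theorem integrable_weight_mul_heatCov {H κ : ℝ} (hH0 : 0 < H) (hH1 : H < 1) (hκ : 0 < κ)
    (t s d : ℝ) (ht : 0 ≤ t) (hs : 0 ≤ s) :
    Integrable (fun z : ℝ × ℝ => noiseConst H * |z.2| ^ (1 - 2 * H) * heatCov κ t s d z)
      ((volume.restrict (Ioi 0)).prod volume) := by
  have hc := noiseConst_pos hH0 hH1
  have hmeas : ∀ d, AEStronglyMeasurable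
      (fun z : ℝ × ℝ => noiseConst H * |z.2| ^ (1 - 2 * H) * heatCov κ t s d z)
      ((volume.restrict (Ioi 0)).prod volume) := fun d => by
    have := measurable_heatCov κ t s d
    exact (by fun_prop : Measurable
      fun z : ℝ × ℝ => noiseConst H * |z.2| ^ (1 - 2 * H) * heatCov κ t s d z).aestronglyMeasurable
  have hnn : ∀ z, 0 ≤ heatCov κ t s 0 z := fun z => (abs_nonneg _).trans (abs_heatCov_le κ t s 0 z)
  have h0 : Integrable (fun z : ℝ × ℝ => noiseConst H * |z.2| ^ (1 - 2 * H) * heatCov κ t s 0 z)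
      ((volume.restrict (Ioi 0)).prod volume) := by
    -- Integrating in ξ first leaves a multiple of ((t+s)/2 - r)^{H-1}. Its only possible
    -- singularity, at r = t when t = s, is integrable because H > 0. The case d = 0 then dominates
    -- all d.
    rw [integrable_prod_iff (hmeas 0)]
    refine ⟨ae_of_all _ fun r => ?_, ?_⟩
    · simp_rw [weight_mul_heatCov_zero]
      by_cases h : 0 < r ∧ r < min t s
      · have hpos : 0 < (t + s) / 2 - r := by
          have := h.2.trans_le (min_le_left _ _); have := h.2.trans_le (min_le_right _ _); linarith
        exact (integrable_abs_rpow_mul_exp (by positivity) (by linarith)).const_mul _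
      · simp only [if_neg h, zero_mul]
        exact integrable_zero _ _ _
    · have e : ∀ z : ℝ × ℝ, ‖noiseConst H * |z.2| ^ (1 - 2 * H) * heatCov κ t s 0 z‖ =
          noiseConst H * |z.2| ^ (1 - 2 * H) * heatCov κ t s 0 z := fun z => by
        have := hnn z
        rw [Real.norm_eq_abs, abs_of_nonneg (by positivity)]
      refine Integrable.congr (f := (Ioo 0 (min t s)).indicator (fun r => noiseConst H *
        Real.Gamma (1 - H) * κ ^ (H - 1) * ((t + s) / 2 - r) ^ (H - 1))) ?_ ?_
      · rw [integrable_indicator_iff measurableSet_Ioo]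
        exact ((integrableOn_sub_rpow hH0 (le_min ht hs)).const_mul _).mono_measure
          (Measure.restrict_mono le_rfl Measure.restrict_le_self)
      · filter_upwards [ae_restrict_mem measurableSet_Ioi] with r hr
        rw [← integral_weight_mul_heatCov_zero hH1 hκ hr]
        exact integral_congr_ae (ae_of_all _ fun ξ => (e (r, ξ)).symm)
  refine h0.mono' (hmeas d) (ae_of_all _ fun z => ?_)
  rw [Real.norm_eq_abs, abs_mul, abs_of_nonneg (by positivity)]
  exact mul_le_mul_of_nonneg_left (abs_heatCov_le κ t s d z) (by positivity)

/-- Covariance at a fixed space point. -/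
theorem integral_heatCov_zero {H κ : ℝ} (hH0 : 0 < H) (hH1 : H < 1) (hκ : 0 < κ)
    {t s : ℝ} (ht : 0 ≤ t) (hs : 0 ≤ s) :
    ∫ z, heatCov κ t s 0 z ∂(spectralMeasure H) =
      noiseConst H * Real.Gamma (1 - H) * κ ^ (H - 1) / (H * 2 ^ H) *
        ((t + s) ^ H - |t - s| ^ H) := by
  rw [integral_spectralMeasure hH0 hH1,
    integral_prod _ (integrable_weight_mul_heatCov hH0 hH1 hκ t s 0 ht hs)]
  have e : ∫ r in Ioi (0 : ℝ), ∫ ξ, noiseConst H * |ξ| ^ (1 - 2 * H) * heatCov κ t s 0 (r, ξ) =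
      ∫ r in Ioi (0 : ℝ), (Ioo 0 (min t s)).indicator (fun r => noiseConst H * Real.Gamma (1 - H) *
        κ ^ (H - 1) * ((t + s) / 2 - r) ^ (H - 1)) r :=
    setIntegral_congr_fun measurableSet_Ioi fun r hr =>
      integral_weight_mul_heatCov_zero hH1 hκ hr
  rw [e, setIntegral_indicator measurableSet_Ioo,
    inter_eq_right.2 Ioo_subset_Ioi_self, integral_const_mul,
    integral_sub_rpow hH0 (le_min ht hs)]
  have e1 : (t + s) / 2 - min t s = |t - s| / 2 := by
    rcases le_total t s with h | h
    · rw [min_eq_left h, abs_of_nonpos (by linarith)]; ring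
    · rw [min_eq_right h, abs_of_nonneg (by linarith)]; ring
  rw [e1, Real.div_rpow (by linarith) (by norm_num), Real.div_rpow (abs_nonneg _) (by norm_num)]
  field_simp

/-- Covariance at a fixed time. -/
theorem integral_heatCov_self {H κ : ℝ} (hH0 : 0 < H) (hH1 : H < 1) (hκ : 0 < κ)
    {t : ℝ} (ht : 0 ≤ t) (d : ℝ) :
    Integrable (fun ξ : ℝ => |ξ| ^ (-1 - 2 * H) * (1 - Real.exp (-(κ * t * ξ ^ 2))) *
      Real.cos (ξ * d)) ∧
    ∫ z, heatCov κ t t d z ∂(spectralMeasure H) =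
      noiseConst H / κ * ∫ ξ, |ξ| ^ (-1 - 2 * H) * (1 - Real.exp (-(κ * t * ξ ^ 2))) *
        Real.cos (ξ * d) := by
  have hc := noiseConst_pos hH0 hH1
  have hint := integrable_weight_mul_heatCov hH0 hH1 hκ t t d ht ht
  -- Here time is integrated first, which divides the weight by κξ² and turns the exponent 1-2H into
  -- -1-2H. The point ξ = 0 is a null set.
  have hinner : ∀ ξ : ℝ, ξ ≠ 0 → ∫ r in Ioi (0 : ℝ), noiseConst H * |ξ| ^ (1 - 2 * H) *
      heatCov κ t t d (r, ξ) = noiseConst H / κ * (|ξ| ^ (-1 - 2 * H) *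
        (1 - Real.exp (-(κ * t * ξ ^ 2))) * Real.cos (ξ * d)) := by
    intro ξ hξ
    have hξ2 : 0 < κ * ξ ^ 2 := by positivity
    have e0 : ∀ r, heatCov κ t t d (r, ξ) = (Ioo 0 t).indicator (fun r =>
        Real.cos (ξ * d) * Real.exp (-(κ * t * ξ ^ 2)) * Real.exp (κ * ξ ^ 2 * r)) r := by
      intro r
      unfold heatCov
      simp only [min_self, indicator, mem_Ioo]
      split_ifs
      · rw [mul_assoc (Real.cos (ξ * d)) (Real.exp _), ← Real.exp_add]; congr 2; ring
      · rfl
    simp_rw [e0]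
    rw [integral_const_mul, setIntegral_indicator measurableSet_Ioo,
      inter_eq_right.2 Ioo_subset_Ioi_self, integral_const_mul,
      ← integral_Ioc_eq_integral_Ioo, ← intervalIntegral.integral_of_le ht,
      intervalIntegral.integral_comp_mul_left (fun x => Real.exp x) hξ2.ne', integral_exp,
      mul_zero, Real.exp_zero, smul_eq_mul]
    have e1 : |ξ| ^ (1 - 2 * H) = |ξ| ^ (-1 - 2 * H) * ξ ^ 2 := by
      rw [← sq_abs, ← Real.rpow_two, ← Real.rpow_add (abs_pos.2 hξ)]; congr 1; ring
    have e2 : Real.exp (-(κ * t * ξ ^ 2)) * (Real.exp (κ * ξ ^ 2 * t) - 1) =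
        1 - Real.exp (-(κ * t * ξ ^ 2)) := by
      rw [mul_sub, ← Real.exp_add, show -(κ * t * ξ ^ 2) + κ * ξ ^ 2 * t = 0 by ring,
        Real.exp_zero, mul_one]
    rw [e1, ← e2]
    field_simp
  have hae : (fun ξ : ℝ => ∫ r in Ioi (0 : ℝ), noiseConst H * |ξ| ^ (1 - 2 * H) *
      heatCov κ t t d (r, ξ)) =ᵐ[volume] fun ξ => noiseConst H / κ * (|ξ| ^ (-1 - 2 * H) *
        (1 - Real.exp (-(κ * t * ξ ^ 2))) * Real.cos (ξ * d)) := by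
    filter_upwards [compl_mem_ae_iff.2 (measure_singleton (0 : ℝ))] with ξ hξ
    exact hinner ξ hξ
  constructor
  · have h1 := (hint.integral_prod_right.congr hae).const_mul (noiseConst H / κ)⁻¹
    refine h1.congr (ae_of_all _ fun ξ => ?_)
    dsimp only
    rw [← mul_assoc, inv_mul_cancel₀ (by positivity), one_mul]
  · rw [integral_spectralMeasure hH0 hH1, integral_prod_symm _ hint, ← integral_const_mul]
    exact integral_congr_ae hae

/-- The squared modulus kills the phase and equals `heatCov κ t t 0`, whose integrability is known.
-/
theorem memLp_spaceFourier_convKernel {H κ : ℝ} (hH0 : 0 < H) (hH1 : H < 1) (hκ : 0 < κ)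
    {t : ℝ} (ht : 0 ≤ t) (x : ℝ) :
    MemLp (spaceFourier (convKernel κ t x)) 2 (spectralMeasure H) := by
  have hm : Measurable (spaceFourier (convKernel κ t x)) := by
    rw [funext (spaceFourier_convKernel hκ t x)]
    refine Measurable.ite ?_ (by fun_prop) measurable_const
    exact (measurableSet_lt measurable_const measurable_fst).inter
      (measurableSet_lt measurable_fst measurable_const)
  rw [memLp_two_iff_integrable_sq_norm hm.aestronglyMeasurable]
  have h := (integrable_spectralMeasure_iff hH0 hH1 (f := heatCov κ t t 0)).2
    (by simpa using integrable_weight_mul_heatCov hH0 hH1 hκ t t 0 ht ht)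
  refine h.congr (ae_of_all _ fun z => ?_)
  dsimp only
  rw [spaceFourier_convKernel hκ, heatCov]
  simp only [min_self]
  split_ifs
  · rw [norm_mul, Complex.norm_exp, Complex.norm_exp, Complex.ofReal_re, ← Real.exp_add,
      ← Real.exp_nat_mul]
    simp
    ring
  · simp

/-! ### Covariance of the stochastic convolution. -/

section

variable {Ω : Type*} [MeasurableSpace Ω] {P : Measure Ω} {H κ : ℝ}
  {W : TestFun → Ω → ℝ} {u : ℝ → ℝ → Ω → ℝ}

theorem re_exp_mul_conj_exp (ξ x y A B : ℝ) :
    (Complex.exp (-(Complex.I * ξ * x)) * Complex.exp (A : ℂ) *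
      (starRingEnd ℂ) (Complex.exp (-(Complex.I * ξ * y)) * Complex.exp (B : ℂ))).re =
      Real.cos (ξ * (x - y)) * Real.exp (A + B) := by
  rw [map_mul (starRingEnd ℂ), ← Complex.exp_conj, ← Complex.exp_conj, ← Complex.exp_add,
    ← Complex.exp_add, ← Complex.exp_add, Complex.exp_re, mul_comm, ← Real.cos_neg (ξ * (x - y))]
  congr 1
  · congr 1
    simp
    ring
  · congr 1
    simp

/-- The covariance of the stochastic convolution. -/
theorem IsStochasticConvolution.integral_mul (hu : IsStochasticConvolution H κ P W u)
    (hW : IsFractionalNoise H P W) (hH0 : 0 < H) (hH1 : H < 1) (hκ : 0 < κ) {t s : ℝ}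
    (ht : 0 ≤ t) (hs : 0 ≤ s) (x y : ℝ) :
    ∫ ω, u t x ω * u s y ω ∂P = ∫ z, heatCov κ t s (x - y) z ∂(spectralMeasure H) := by
  have h₁ := memLp_spaceFourier_convKernel hH0 hH1 hκ ht x
  have h₂ := memLp_spaceFourier_convKernel hH0 hH1 hκ hs y
  have h := hW.integral_mul_eq (hu t x ht) (hu s y hs) h₁ h₂
  have hi : Integrable (fun z => spaceFourier (convKernel κ t x) z *
      (starRingEnd ℂ) (spaceFourier (convKernel κ s y) z)) (spectralMeasure H) :=
    h₁.integrable_mul h₂.star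
  have h' := congrArg Complex.re h
  rw [Complex.ofReal_re] at h'
  rw [h', ← RCLike.re_eq_complex_re, ← integral_re hi]
  refine integral_congr_ae (ae_of_all _ fun z => ?_)
  dsimp only
  rw [spaceFourier_convKernel hκ, spaceFourier_convKernel hκ, heatCov]
  by_cases hz : 0 < z.1 ∧ z.1 < min t s
  · rw [if_pos hz, if_pos ⟨hz.1, hz.2.trans_le (min_le_left _ _)⟩,
      if_pos ⟨hz.1, hz.2.trans_le (min_le_right _ _)⟩, RCLike.re_eq_complex_re, re_exp_mul_conj_exp]
    congr 2
    ring
  · rw [if_neg hz]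
    rw [lt_min_iff] at hz
    by_cases h1 : 0 < z.1 ∧ z.1 < t
    · rw [if_neg (fun h2 : 0 < z.1 ∧ z.1 < s => hz ⟨h1.1, h1.2, h2.2⟩)]; simp
    · rw [if_neg h1]; simp

end

/-! ### The integrals that fix the noise constant. -/

/-- Fubini's theorem for nonnegative functions, with integrability of one iterated integral. -/
theorem integral_integral_swap_of_nonneg {α β : Type*} [MeasurableSpace α] [MeasurableSpace β]
    {μ : Measure α} {ν : Measure β} [SFinite μ] [SFinite ν] {f : α → β → ℝ}
    (hf : AEStronglyMeasurable (Function.uncurry f) (μ.prod ν)) (hnn : ∀ᵐ x ∂μ, 0 ≤ᵐ[ν] f x)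
    (h1 : ∀ᵐ x ∂μ, Integrable (f x) ν) (h2 : Integrable (fun x => ∫ y, f x y ∂ν) μ) :
    Integrable (fun y => ∫ x, f x y ∂μ) ν ∧
      ∫ y, ∫ x, f x y ∂μ ∂ν = ∫ x, ∫ y, f x y ∂ν ∂μ := by
  have hint : Integrable (Function.uncurry f) (μ.prod ν) := by
    rw [integrable_prod_iff hf]
    refine ⟨h1, h2.congr ?_⟩
    filter_upwards [hnn] with x hx
    refine integral_congr_ae ?_
    filter_upwards [hx] with y hy
    simp only [Function.uncurry_apply_pair, Real.norm_eq_abs]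
    exact (abs_of_nonneg hy).symm
  exact ⟨hint.integral_prod_right, (integral_integral_swap hint).symm⟩

/-- Write 1/(1+v²) as the integral of e^{-w(1+v²)} over w > 0 and exchange: the v-integral gives
Γ(H)w^{-H}/2, and the w-integral then gives Γ(1-H). -/
theorem integral_rpow_div_one_add_sq {H : ℝ} (hH0 : 0 < H) (hH1 : H < 1) :
    IntegrableOn (fun v : ℝ => v ^ (2 * H - 1) / (1 + v ^ 2)) (Ioi 0) ∧
    ∫ v in Ioi (0 : ℝ), v ^ (2 * H - 1) / (1 + v ^ 2) = Real.Gamma H * Real.Gamma (1 - H) / 2 := by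
  have hin : ∀ w : ℝ, 0 < w → ∫ v in Ioi (0 : ℝ), Real.exp (-w) *
      (v ^ (2 * H - 1) * Real.exp (-w * v ^ (2 : ℝ))) =
      Real.Gamma H / 2 * (Real.exp (-w) * w ^ ((1 - H) - 1)) := by
    intro w hw
    rw [integral_const_mul, integral_rpow_mul_exp_neg_mul_rpow (by norm_num) (by linarith) hw,
      show -(2 * H - 1 + 1) / 2 = (1 - H) - 1 by ring, show (2 * H - 1 + 1) / 2 = H by ring]
    ring
  have hout : ∀ v : ℝ, 0 < v → ∫ w in Ioi (0 : ℝ), Real.exp (-w) *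
      (v ^ (2 * H - 1) * Real.exp (-w * v ^ (2 : ℝ))) = v ^ (2 * H - 1) / (1 + v ^ 2) := by
    intro v hv
    have e : ∀ w : ℝ, Real.exp (-w) * (v ^ (2 * H - 1) * Real.exp (-w * v ^ (2 : ℝ))) =
        v ^ (2 * H - 1) * Real.exp (-(1 + v ^ 2) * w) := by
      intro w
      rw [mul_left_comm, ← Real.exp_add, Real.rpow_two]
      congr 2; ring
    simp_rw [e]
    rw [integral_const_mul, integral_exp_mul_Ioi (by nlinarith [sq_nonneg v])]
    rw [mul_zero, Real.exp_zero, neg_div_neg_eq, mul_one_div]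
  have hmeas : Measurable (Function.uncurry fun w v : ℝ => Real.exp (-w) *
      (v ^ (2 * H - 1) * Real.exp (-w * v ^ (2 : ℝ)))) := by
    simp only [Function.uncurry_def]
    fun_prop
  have hGi : Integrable (fun w : ℝ => Real.Gamma H / 2 * (Real.exp (-w) * w ^ ((1 - H) - 1)))
      (volume.restrict (Ioi 0)) :=
    (Real.GammaIntegral_convergent (s := 1 - H) (by linarith)).const_mul _
  obtain ⟨h1, h2⟩ := integral_integral_swap_of_nonneg (μ := volume.restrict (Ioi (0 : ℝ)))
    (ν := volume.restrict (Ioi (0 : ℝ))) hmeas.aestronglyMeasurable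
    (ae_of_all _ fun w => by
      filter_upwards [ae_restrict_mem measurableSet_Ioi] with v hv
      have : (0 : ℝ) < v := hv
      simp only [Pi.zero_apply]; positivity)
    (by
      filter_upwards [ae_restrict_mem measurableSet_Ioi] with w hw
      exact (integrableOn_rpow_mul_exp_neg_mul_rpow (by linarith) (by norm_num) hw).const_mul _)
    (hGi.congr (by
      filter_upwards [ae_restrict_mem measurableSet_Ioi] with w hw
      exact (hin w hw).symm))
  constructor
  · refine h1.congr ?_
    filter_upwards [ae_restrict_mem measurableSet_Ioi] with v hv
    exact hout v hv
  · rw [setIntegral_congr_fun measurableSet_Ioi fun v hv => hout v hv,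
      setIntegral_congr_fun measurableSet_Ioi fun w hw => hin w hw, integral_const_mul,
      ← Real.Gamma_eq_integral (by linarith)] at h2
    rw [h2]; ring

theorem integral_exp_mul_one_sub_cos {v : ℝ} (hv : 0 < v) :
    IntegrableOn (fun ξ : ℝ => Real.exp (-(v * ξ)) * (1 - Real.cos ξ)) (Ioi 0) ∧
    ∫ ξ in Ioi (0 : ℝ), Real.exp (-(v * ξ)) * (1 - Real.cos ξ) = 1 / (v * (1 + v ^ 2)) := by
  have ha : (-(v : ℂ) + Complex.I).re < 0 := by simpa using hv
  have hb : (-(v : ℂ)).re < 0 := by simpa using hv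
  have i1 := integrableOn_exp_mul_complex_Ioi ha 0
  have i2 := integrableOn_exp_mul_complex_Ioi hb 0
  have hpt : ∀ ξ : ℝ, Real.exp (-(v * ξ)) * (1 - Real.cos ξ) =
      RCLike.re (Complex.exp (-(v : ℂ) * ξ) - Complex.exp ((-(v : ℂ) + Complex.I) * ξ)) := by
    intro ξ
    rw [RCLike.re_eq_complex_re, Complex.sub_re, Complex.exp_re, Complex.exp_re]
    simp
    ring
  have i3 := i2.sub i1
  simp_rw [hpt]
  refine ⟨i3.re, ?_⟩
  have := integral_re i3
  simp only [Pi.sub_apply] at this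
  rw [this, integral_sub i2 i1, integral_exp_mul_complex_Ioi ha, integral_exp_mul_complex_Ioi hb]
  simp only [Complex.ofReal_zero, mul_zero, Complex.exp_zero, RCLike.re_eq_complex_re,
    Complex.sub_re, Complex.div_re]
  simp [Complex.normSq_apply]
  field_simp
  ring

/-- Write Γ(2H+1)ξ^{-1-2H} as the integral of v^{2H}e^{-vξ} over v > 0. Exchanging leaves the
Laplace transform of 1 - cos, and then the integral of v^{2H-1}/(1+v²). -/
theorem integral_rpow_mul_one_sub_cos_Ioi {H : ℝ} (hH0 : 0 < H) (hH1 : H < 1) :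
    ∫ ξ in Ioi (0 : ℝ), ξ ^ (-1 - 2 * H) * (1 - Real.cos ξ) =
      Real.Gamma H * Real.Gamma (1 - H) / (2 * Real.Gamma (2 * H + 1)) := by
  obtain ⟨hA1, hA2⟩ := integral_rpow_div_one_add_sq hH0 hH1
  have hG := Real.Gamma_pos_of_pos (s := 2 * H + 1) (by linarith)
  have hin : ∀ v : ℝ, 0 < v → ∫ ξ in Ioi (0 : ℝ), v ^ (2 * H) *
      (Real.exp (-(v * ξ)) * (1 - Real.cos ξ)) = v ^ (2 * H - 1) / (1 + v ^ 2) := by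
    intro v hv
    rw [integral_const_mul, (integral_exp_mul_one_sub_cos hv).2, Real.rpow_sub_one hv.ne']
    field_simp
  have hout : ∀ ξ : ℝ, 0 < ξ → ∫ v in Ioi (0 : ℝ), v ^ (2 * H) *
      (Real.exp (-(v * ξ)) * (1 - Real.cos ξ)) =
      Real.Gamma (2 * H + 1) * (ξ ^ (-1 - 2 * H) * (1 - Real.cos ξ)) := by
    intro ξ hξ
    have e : ∀ v : ℝ, v ^ (2 * H) * (Real.exp (-(v * ξ)) * (1 - Real.cos ξ)) =
        (1 - Real.cos ξ) * (v ^ ((2 * H + 1) - 1) * Real.exp (-(ξ * v))) := by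
      intro v; rw [mul_comm v ξ, add_sub_cancel_right]; ring
    simp_rw [e]
    rw [integral_const_mul, Real.integral_rpow_mul_exp_neg_mul_Ioi (by linarith) hξ, one_div,
      Real.inv_rpow hξ.le, ← Real.rpow_neg hξ.le]
    ring_nf
  have hmeas : Measurable (Function.uncurry fun v ξ : ℝ => v ^ (2 * H) *
      (Real.exp (-(v * ξ)) * (1 - Real.cos ξ))) := by
    simp only [Function.uncurry_def]
    fun_prop
  obtain ⟨-, h2⟩ := integral_integral_swap_of_nonneg (μ := volume.restrict (Ioi (0 : ℝ)))
    (ν := volume.restrict (Ioi (0 : ℝ))) hmeas.aestronglyMeasurable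
    (by
      filter_upwards [ae_restrict_mem measurableSet_Ioi] with v hv
      refine ae_of_all _ fun ξ => ?_
      have : (0 : ℝ) < v := hv
      have := Real.cos_le_one ξ
      simp only [Pi.zero_apply]
      exact mul_nonneg (by positivity) (mul_nonneg (by positivity) (by linarith)))
    (by
      filter_upwards [ae_restrict_mem measurableSet_Ioi] with v hv
      exact (integral_exp_mul_one_sub_cos hv).1.const_mul _)
    (Integrable.congr hA1 (by
      filter_upwards [ae_restrict_mem measurableSet_Ioi] with v hv
      exact (hin v hv).symm))
  rw [setIntegral_congr_fun measurableSet_Ioi fun ξ hξ => hout ξ hξ,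
    setIntegral_congr_fun measurableSet_Ioi fun v hv => hin v hv, integral_const_mul, hA2] at h2
  field_simp
  linarith

/-- Scaling reduces to d = 1, where the reflection formula for Γ(H)Γ(1-H) produces the sine in
`noiseConst`. This is the normalisation that makes the noise fractional with unit constant in space.
-/
theorem integral_abs_rpow_mul_one_sub_cos {H : ℝ} (hH0 : 0 < H) (hH1 : H < 1) (d : ℝ) :
    Integrable (fun ξ : ℝ => |ξ| ^ (-1 - 2 * H) * (1 - Real.cos (ξ * d))) ∧
    ∫ ξ : ℝ, |ξ| ^ (-1 - 2 * H) * (1 - Real.cos (ξ * d)) = |d| ^ (2 * H) / (2 * noiseConst H) := by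
  have hc := noiseConst_pos hH0 hH1
  have hG := Real.Gamma_pos_of_pos (s := 2 * H + 1) (by linarith)
  have hone : ∫ ξ : ℝ, |ξ| ^ (-1 - 2 * H) * (1 - Real.cos ξ) = 1 / (2 * noiseConst H) := by
    have h := integral_comp_abs (f := fun ξ : ℝ => ξ ^ (-1 - 2 * H) * (1 - Real.cos ξ))
    simp only [Real.cos_abs] at h
    have hs : 0 < Real.sin (Real.pi * H) :=
      Real.sin_pos_of_pos_of_lt_pi (by positivity) (by nlinarith [Real.pi_pos])
    rw [h, integral_rpow_mul_one_sub_cos_Ioi hH0 hH1, Real.Gamma_mul_Gamma_one_sub, noiseConst,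
      mul_comm H Real.pi]
    field_simp
  have hi : Integrable fun ξ : ℝ => |ξ| ^ (-1 - 2 * H) * (1 - Real.cos ξ) := by
    refine not_imp_comm.1 integral_undef ?_
    rw [hone]; positivity
  rcases eq_or_ne d 0 with rfl | hd
  · simp [Real.zero_rpow (show 2 * H ≠ 0 by positivity)]
  have e : ∀ ξ : ℝ, |ξ| ^ (-1 - 2 * H) * (1 - Real.cos (ξ * d)) =
      |d| ^ (1 + 2 * H) * (|ξ * d| ^ (-1 - 2 * H) * (1 - Real.cos (ξ * d))) := by
    intro ξ
    rw [abs_mul, Real.mul_rpow (abs_nonneg _) (abs_nonneg _), show -1 - 2 * H = -(1 + 2 * H) by ring,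
      Real.rpow_neg (abs_nonneg d)]
    have : 0 < |d| ^ (1 + 2 * H) := Real.rpow_pos_of_pos (abs_pos.2 hd) _
    field_simp
  simp_rw [e]
  refine ⟨(hi.comp_mul_right' hd).const_mul _, ?_⟩
  rw [integral_const_mul, Measure.integral_comp_mul_right
    (fun ξ : ℝ => |ξ| ^ (-1 - 2 * H) * (1 - Real.cos ξ)) d, hone, smul_eq_mul, abs_inv,
    Real.rpow_add (abs_pos.2 hd), Real.rpow_one]
  have := abs_pos.2 hd
  field_simp

/-! ### The remainder in the spatial variogram. -/

/-- The smooth part of the spatial variogram. -/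
def spaceRemainder (H κ t d : ℝ) : ℝ :=
  noiseConst H / κ * ∫ ξ : ℝ, Real.exp (-(κ * t * ξ ^ 2)) *
    (|ξ| ^ (-1 - 2 * H) * (1 - Real.cos (ξ * d)))

theorem integrable_spaceRemainder {H κ t : ℝ} (hH0 : 0 < H) (hH1 : H < 1) (hκ : 0 < κ) (ht : 0 < t)
    (d : ℝ) : Integrable fun ξ : ℝ => Real.exp (-(κ * t * ξ ^ 2)) *
      (|ξ| ^ (-1 - 2 * H) * (1 - Real.cos (ξ * d))) := by
  refine (integral_abs_rpow_mul_one_sub_cos hH0 hH1 d).1.bdd_mul (c := 1)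
    (by fun_prop : Measurable fun ξ : ℝ => Real.exp (-(κ * t * ξ ^ 2))).aestronglyMeasurable
    (ae_of_all _ fun ξ => ?_)
  rw [Real.norm_eq_abs, Real.abs_exp, Real.exp_le_one_iff]
  have : 0 ≤ κ * t * ξ ^ 2 := by positivity
  linarith

theorem spaceRemainder_nonneg {H κ t : ℝ} (hH0 : 0 < H) (hH1 : H < 1) (hκ : 0 < κ) (d : ℝ) :
    0 ≤ spaceRemainder H κ t d := by
  have hc := noiseConst_pos hH0 hH1
  refine mul_nonneg (by positivity) (integral_nonneg fun ξ => ?_)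
  have := Real.cos_le_one (ξ * d)
  exact mul_nonneg (by positivity) (mul_nonneg (by positivity) (by linarith))

/-- From 1 - cos y ≤ y²/2: the Gaussian factor, available since t > 0, makes the resulting moment
finite. The order d² is negligible against |d|^{2H} as H < 1. -/
theorem exists_spaceRemainder_le {H κ t : ℝ} (hH0 : 0 < H) (hH1 : H < 1) (hκ : 0 < κ) (ht : 0 < t) :
    ∃ C, 0 ≤ C ∧ ∀ d, spaceRemainder H κ t d ≤ C * d ^ 2 := by
  have hc := noiseConst_pos hH0 hH1
  have hi := integrable_abs_rpow_mul_exp (b := κ * t) (q := 1 - 2 * H) (by positivity) (by linarith)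
  refine ⟨noiseConst H / κ * ((∫ ξ : ℝ, |ξ| ^ (1 - 2 * H) * Real.exp (-(κ * t * ξ ^ 2))) / 2),
    mul_nonneg (by positivity) (div_nonneg (integral_nonneg fun ξ => by positivity) (by norm_num)),
    fun d => ?_⟩
  rw [mul_assoc, spaceRemainder]
  refine mul_le_mul_of_nonneg_left ?_ (by positivity)
  rw [div_mul_eq_mul_div, mul_div_assoc, ← integral_mul_const]
  refine integral_mono_ae (integrable_spaceRemainder hH0 hH1 hκ ht d) (hi.mul_const _) ?_
  filter_upwards [compl_mem_ae_iff.2 (measure_singleton (0 : ℝ))] with ξ hξ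
  have hξ' : 0 < |ξ| := abs_pos.2 hξ
  have e1 : |ξ| ^ (1 - 2 * H) = |ξ| ^ (-1 - 2 * H) * ξ ^ 2 := by
    rw [← sq_abs, ← Real.rpow_two, ← Real.rpow_add hξ']; congr 1; ring
  have h1 := Real.one_sub_sq_div_two_le_cos (x := ξ * d)
  rw [e1]
  calc Real.exp (-(κ * t * ξ ^ 2)) * (|ξ| ^ (-1 - 2 * H) * (1 - Real.cos (ξ * d))) ≤
      Real.exp (-(κ * t * ξ ^ 2)) * (|ξ| ^ (-1 - 2 * H) * ((ξ * d) ^ 2 / 2)) := by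
        gcongr
        linarith
    _ = _ := by ring

/-- The second difference of 1 - cos(ξ·) at d is 2cos(ξd)(1 - cos(ξh)). The bound is uniform in d,
so every increment covariance receives an error of only O(h²). -/
theorem abs_secondDiff_spaceRemainder_le {H κ t : ℝ} (hH0 : 0 < H) (hH1 : H < 1) (hκ : 0 < κ)
    (ht : 0 < t) (d h : ℝ) :
    |spaceRemainder H κ t (d + h) + spaceRemainder H κ t (d - h) - 2 * spaceRemainder H κ t d| ≤
      2 * spaceRemainder H κ t h := by
  have hc := noiseConst_pos hH0 hH1
  have hi := integrable_spaceRemainder hH0 hH1 hκ ht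
  have e : spaceRemainder H κ t (d + h) + spaceRemainder H κ t (d - h) - 2 * spaceRemainder H κ t d =
      noiseConst H / κ * ∫ ξ : ℝ, (Real.exp (-(κ * t * ξ ^ 2)) *
        (|ξ| ^ (-1 - 2 * H) * (1 - Real.cos (ξ * h)))) * (2 * Real.cos (ξ * d)) := by
    have hsplit : ∫ ξ : ℝ, (Real.exp (-(κ * t * ξ ^ 2)) *
        (|ξ| ^ (-1 - 2 * H) * (1 - Real.cos (ξ * h)))) * (2 * Real.cos (ξ * d)) =
        ∫ ξ : ℝ, (Real.exp (-(κ * t * ξ ^ 2)) *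
          (|ξ| ^ (-1 - 2 * H) * (1 - Real.cos (ξ * (d + h)))) +
        Real.exp (-(κ * t * ξ ^ 2)) * (|ξ| ^ (-1 - 2 * H) * (1 - Real.cos (ξ * (d - h))))) -
        2 * (Real.exp (-(κ * t * ξ ^ 2)) * (|ξ| ^ (-1 - 2 * H) * (1 - Real.cos (ξ * d)))) := by
      congr 1
      ext ξ
      rw [mul_add ξ, mul_sub ξ, Real.cos_add, Real.cos_sub]
      ring
    have iadd : Integrable fun ξ : ℝ => Real.exp (-(κ * t * ξ ^ 2)) *
          (|ξ| ^ (-1 - 2 * H) * (1 - Real.cos (ξ * (d + h)))) +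
        Real.exp (-(κ * t * ξ ^ 2)) * (|ξ| ^ (-1 - 2 * H) * (1 - Real.cos (ξ * (d - h)))) :=
      (hi (d + h)).add (hi (d - h))
    rw [hsplit, integral_sub iadd ((hi d).const_mul 2), integral_add (hi _) (hi _),
      integral_const_mul]
    simp only [spaceRemainder]
    ring
  rw [e, abs_mul, abs_of_pos (by positivity : 0 < noiseConst H / κ), spaceRemainder, mul_left_comm,
    ← integral_const_mul]
  refine mul_le_mul_of_nonneg_left ?_ (by positivity)
  refine (abs_integral_le_integral_abs).trans ?_
  refine integral_mono_of_nonneg (ae_of_all _ fun ξ => abs_nonneg _) ((hi h).const_mul 2)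
    (ae_of_all _ fun ξ => ?_)
  dsimp only
  have h1 := Real.cos_le_one (ξ * h)
  have h2 := Real.abs_cos_le_one (ξ * d)
  have h3 : 0 ≤ Real.exp (-(κ * t * ξ ^ 2)) * (|ξ| ^ (-1 - 2 * H) * (1 - Real.cos (ξ * h))) :=
    mul_nonneg (by positivity) (mul_nonneg (by positivity) (by linarith))
  rw [abs_mul, abs_of_nonneg h3, abs_mul, abs_two]
  nlinarith

/-- The spatial variogram of the stochastic convolution. -/
theorem integral_heatCov_sub {H κ t : ℝ} (hH0 : 0 < H) (hH1 : H < 1) (hκ : 0 < κ) (ht : 0 < t)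
    (d : ℝ) :
    ∫ z, heatCov κ t t 0 z ∂(spectralMeasure H) - ∫ z, heatCov κ t t d z ∂(spectralMeasure H) =
      |d| ^ (2 * H) / (2 * κ) - spaceRemainder H κ t d := by
  have hc := noiseConst_pos hH0 hH1
  obtain ⟨i0, h0⟩ := integral_heatCov_self hH0 hH1 hκ ht.le 0
  obtain ⟨i1, h1⟩ := integral_heatCov_self hH0 hH1 hκ ht.le d
  obtain ⟨i2, h2⟩ := integral_abs_rpow_mul_one_sub_cos hH0 hH1 d
  rw [h0, h1, ← mul_sub, ← integral_sub i0 i1, spaceRemainder]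
  have e : |d| ^ (2 * H) / (2 * κ) = noiseConst H / κ *
      ∫ ξ : ℝ, |ξ| ^ (-1 - 2 * H) * (1 - Real.cos (ξ * d)) := by
    rw [h2]; field_simp
  rw [e, ← mul_sub, ← integral_sub i2 (integrable_spaceRemainder hH0 hH1 hκ ht d)]
  congr 2
  ext ξ
  rw [mul_zero, Real.cos_zero]
  ring

/-! ### Second differences of powers and their row sums. -/

/-- The second difference of `|·|^α` at an integer. -/
def secondDiff (α : ℝ) (m : ℤ) : ℝ :=
  |(m : ℝ) + 1| ^ α + |(m : ℝ) - 1| ^ α - 2 * |(m : ℝ)| ^ α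

theorem secondDiff_neg (α : ℝ) (m : ℤ) : secondDiff α (-m) = secondDiff α m := by
  simp only [secondDiff, Int.cast_neg]
  rw [show -(m : ℝ) + 1 = -(m - 1) by ring, show -(m : ℝ) - 1 = -(m + 1) by ring, abs_neg, abs_neg,
    abs_neg]
  ring

theorem secondDiff_zero {α : ℝ} (hα : 0 < α) : secondDiff α 0 = 2 := by
  simp [secondDiff, Real.zero_rpow hα.ne']
  norm_num

/-- At integers ≥ 1 the absolute values disappear, leaving a difference of consecutive increments:
its sign is that of concavity or convexity, and its sum telescopes. -/
theorem secondDiff_natCast_succ (α : ℝ) (m : ℕ) :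
    secondDiff α ((m : ℤ) + 1) =
      (((m : ℝ) + 2) ^ α - ((m : ℝ) + 1) ^ α) - (((m : ℝ) + 1) ^ α - (m : ℝ) ^ α) := by
  simp only [secondDiff]
  push_cast
  rw [abs_of_nonneg (by positivity), abs_of_nonneg (by simp), abs_of_nonneg (by positivity)]
  ring_nf

theorem secondDiff_nonpos {α : ℝ} (hα0 : 0 < α) (hα1 : α ≤ 1) (m : ℕ) :
    secondDiff α ((m : ℤ) + 1) ≤ 0 := by
  have hconc := Real.concaveOn_rpow hα0.le hα1
  have h := hconc.2 (show (m : ℝ) ∈ Ici 0 from mem_Ici.2 (Nat.cast_nonneg m))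
    (show (m : ℝ) + 2 ∈ Ici 0 from by simp only [mem_Ici]; positivity)
    (show (0 : ℝ) ≤ 1 / 2 by norm_num) (show (0 : ℝ) ≤ 1 / 2 by norm_num) (by norm_num)
  rw [secondDiff_natCast_succ]
  simp only [smul_eq_mul] at h
  rw [show 1 / 2 * (m : ℝ) + 1 / 2 * ((m : ℝ) + 2) = m + 1 by ring] at h
  linarith

theorem secondDiff_nonneg {α : ℝ} (hα1 : 1 ≤ α) (m : ℕ) :
    0 ≤ secondDiff α ((m : ℤ) + 1) := by
  have hconv := convexOn_rpow hα1
  have h := hconv.2 (show (m : ℝ) ∈ Ici 0 from mem_Ici.2 (Nat.cast_nonneg m))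
    (show (m : ℝ) + 2 ∈ Ici 0 from by simp only [mem_Ici]; positivity)
    (show (0 : ℝ) ≤ 1 / 2 by norm_num) (show (0 : ℝ) ≤ 1 / 2 by norm_num) (by norm_num)
  rw [secondDiff_natCast_succ]
  simp only [smul_eq_mul] at h
  rw [show 1 / 2 * (m : ℝ) + 1 / 2 * ((m : ℝ) + 2) = m + 1 by ring] at h
  linarith

theorem sum_secondDiff {α : ℝ} (hα : 0 < α) (N : ℕ) :
    ∑ m ∈ Finset.range N, secondDiff α ((m : ℤ) + 1) = ((N : ℝ) + 1) ^ α - (N : ℝ) ^ α - 1 := by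
  induction N with
  | zero => simp [Real.zero_rpow hα.ne']
  | succ N ih =>
    rw [Finset.sum_range_succ, ih, secondDiff_natCast_succ]
    push_cast
    ring_nf

/-- Second differences of a concave or convex power telescope. -/
theorem sum_abs_secondDiff_le {α : ℝ} (hα0 : 0 < α) (hα2 : α < 2) (N : ℕ) :
    ∑ m ∈ Finset.range N, |secondDiff α ((m : ℤ) + 1)| ≤ 2 * ((N : ℝ) + 1) ^ max (α - 1) 0 := by
  have hN1 : (1 : ℝ) ≤ (N : ℝ) + 1 := by simp
  rcases le_total α 1 with h | h
  · rw [Finset.sum_congr rfl fun m _ => abs_of_nonpos (secondDiff_nonpos hα0 h m),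
      Finset.sum_neg_distrib, sum_secondDiff hα0, max_eq_right (by linarith), Real.rpow_zero]
    have : (N : ℝ) ^ α ≤ ((N : ℝ) + 1) ^ α := by gcongr; linarith
    linarith
  · rw [Finset.sum_congr rfl fun m _ => abs_of_nonneg (secondDiff_nonneg h m),
      sum_secondDiff hα0, max_eq_left (by linarith)]
    -- The mean value bound gives the factor α, which is below 2.
    have := abs_abs_rpow_sub_abs_rpow_le h (y := (N : ℝ) + 1) (r := N) (M := (N : ℝ) + 1)
      (abs_of_nonneg (by positivity)).le (by rw [abs_of_nonneg (by positivity)]; linarith)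
    rw [abs_of_nonneg (a := (N : ℝ) + 1) (by positivity), abs_of_nonneg (a := (N : ℝ)) (by positivity),
      add_sub_cancel_left, abs_one, mul_one] at this
    have h3 := (le_abs_self _).trans this
    have h4 : 0 ≤ ((N : ℝ) + 1) ^ (α - 1) := by positivity
    nlinarith

theorem sum_comp_le_sum_range {J : Finset ℤ} {e : ℤ → ℕ} {F : ℕ → ℝ} {N : ℕ} (hF : ∀ m, 0 ≤ F m)
    (he : Set.InjOn e J) (hN : ∀ j ∈ J, e j < N) :
    ∑ j ∈ J, F (e j) ≤ ∑ m ∈ Finset.range N, F m := by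
  classical
  rw [← Finset.sum_image (f := F) he]
  refine Finset.sum_le_sum_of_subset_of_nonneg (fun m hm => ?_) fun m _ _ => hF m
  obtain ⟨j, hj, rfl⟩ := Finset.mem_image.1 hm
  exact Finset.mem_range.2 (hN j hj)

/-- Row sums of second differences. -/
theorem sum_abs_secondDiff_sub_le {α : ℝ} (hα0 : 0 < α) (hα2 : α < 2) {a b i : ℤ} {N : ℕ}
    (hi : i ∈ Finset.Icc a b) (hN : b - a ≤ N) :
    ∑ j ∈ Finset.Icc a b, |secondDiff α (i - j)| ≤ 6 * ((N : ℝ) + 1) ^ max (α - 1) 0 := by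
  rw [Finset.mem_Icc] at hi
  have hS := sum_abs_secondDiff_le hα0 hα2 N
  have h1 : (1 : ℝ) ≤ ((N : ℝ) + 1) ^ max (α - 1) 0 :=
    Real.one_le_rpow (by simp) (le_max_right _ _)
  have hsplit : Finset.Icc a b = Finset.Ico a i ∪ ({i} ∪ Finset.Ioc i b) := by
    ext j; simp only [Finset.mem_Icc, Finset.mem_union, Finset.mem_Ico, Finset.mem_singleton,
      Finset.mem_Ioc]; omega
  have hd1 : Disjoint (Finset.Ico a i) ({i} ∪ Finset.Ioc i b) := by
    rw [Finset.disjoint_left]; intro j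
    simp only [Finset.mem_union, Finset.mem_Ico, Finset.mem_singleton, Finset.mem_Ioc]; omega
  have hd2 : Disjoint {i} (Finset.Ioc i b) := by simp
  rw [hsplit, Finset.sum_union hd1, Finset.sum_union hd2, Finset.sum_singleton, sub_self,
    secondDiff_zero hα0, abs_two]
  have hl : ∑ j ∈ Finset.Ico a i, |secondDiff α (i - j)| ≤
      ∑ m ∈ Finset.range N, |secondDiff α ((m : ℤ) + 1)| := by
    refine le_trans (le_of_eq (Finset.sum_congr rfl fun j hj => ?_)) (sum_comp_le_sum_range
      (J := Finset.Ico a i) (e := fun j => (i - j - 1).toNat)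
      (F := fun m => |secondDiff α ((m : ℤ) + 1)|) (fun m => abs_nonneg _) ?_ ?_)
    · rw [Finset.mem_Ico] at hj
      congr 2; omega
    · intro j hj k hk hjk
      simp only [Finset.coe_Ico, Set.mem_Ico] at hj hk hjk
      omega
    · intro j hj
      rw [Finset.mem_Ico] at hj
      omega
  have hr : ∑ j ∈ Finset.Ioc i b, |secondDiff α (i - j)| ≤
      ∑ m ∈ Finset.range N, |secondDiff α ((m : ℤ) + 1)| := by
    refine le_trans (le_of_eq (Finset.sum_congr rfl fun j hj => ?_)) (sum_comp_le_sum_range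
      (J := Finset.Ioc i b) (e := fun j => (j - i - 1).toNat)
      (F := fun m => |secondDiff α ((m : ℤ) + 1)|) (fun m => abs_nonneg _) ?_ ?_)
    · rw [Finset.mem_Ioc] at hj
      rw [← secondDiff_neg]
      congr 2; omega
    · intro j hj k hk hjk
      simp only [Finset.coe_Ioc, Set.mem_Ioc] at hj hk hjk
      omega
    · intro j hj
      rw [Finset.mem_Ioc] at hj
      omega
  -- The 6 is 2 for the diagonal term plus 2 for each side of it.
  linarith

/-! ### Counting dyadic indices. -/

/-- The index set `a 2^n ≤ i ≤ b 2^n`. -/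
def dyadicIcc (a b : ℝ) (n : ℕ) : Finset ℤ := Finset.Icc ⌈a * 2 ^ n⌉ ⌊b * 2 ^ n⌋

theorem abs_card_dyadicIcc_sub_le {a b : ℝ} (hab : a ≤ b) (n : ℕ) :
    |((dyadicIcc a b n).card : ℝ) - (b - a) * 2 ^ n| ≤ 1 := by
  rw [dyadicIcc, Int.card_Icc]
  have h1 := Int.sub_one_lt_floor (b * 2 ^ n)
  have h2 := Int.floor_le (b * 2 ^ n)
  have h3 := Int.ceil_lt_add_one (a * 2 ^ n)
  have h4 := Int.le_ceil (a * 2 ^ n)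
  have h0 : 0 ≤ (b - a) * 2 ^ n := mul_nonneg (by linarith) (by positivity)
  set F := ⌊b * 2 ^ n⌋
  set G := ⌈a * 2 ^ n⌉
  have hz : (((F + 1 - G).toNat : ℤ) : ℝ) = max ((F : ℝ) + 1 - G) 0 := by
    rw [Int.ofNat_toNat]; push_cast; rfl
  rw [← Int.cast_natCast, hz, abs_le]
  constructor
  · have := le_max_left ((F : ℝ) + 1 - G) 0
    linarith
  · have : max ((F : ℝ) + 1 - G) 0 ≤ (b - a) * 2 ^ n + 1 := max_le (by linarith) (by linarith)
    linarith

theorem tendsto_card_dyadicIcc_div {a b : ℝ} (hab : a ≤ b) :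
    Tendsto (fun n : ℕ => ((dyadicIcc a b n).card : ℝ) / 2 ^ n) atTop (𝓝 (b - a)) := by
  have h0 : Tendsto (fun n : ℕ => ((1 : ℝ) / 2) ^ n) atTop (𝓝 0) :=
    tendsto_pow_atTop_nhds_zero_of_lt_one (by norm_num) (by norm_num)
  rw [tendsto_iff_norm_sub_tendsto_zero]
  refine squeeze_zero (fun _ => norm_nonneg _) (fun n => ?_) h0
  have h := abs_card_dyadicIcc_sub_le hab n
  have h2 : (0 : ℝ) < 2 ^ n := by positivity
  rw [Real.norm_eq_abs, div_sub' h2.ne', abs_div, abs_of_pos h2, div_le_iff₀ h2, div_pow, one_pow,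
    one_div_mul_cancel h2.ne', mul_comm (2 ^ n)]
  exact h

theorem card_dyadicIcc_le {a b : ℝ} (hab : a ≤ b) (n : ℕ) :
    ((dyadicIcc a b n).card : ℝ) ≤ (b - a + 1) * 2 ^ n := by
  have h := (abs_le.1 (abs_card_dyadicIcc_sub_le hab n)).2
  have : (1 : ℝ) ≤ 2 ^ n := one_le_pow₀ (by norm_num)
  linarith

theorem floor_sub_ceil_le {a b : ℝ} {T : ℕ} (hT : b - a ≤ T) (n : ℕ) :
    ⌊b * 2 ^ n⌋ - ⌈a * 2 ^ n⌉ ≤ ((T * 2 ^ n : ℕ) : ℤ) := by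
  have h2 := Int.floor_le (b * 2 ^ n)
  have h4 := Int.le_ceil (a * 2 ^ n)
  have : (0 : ℝ) < 2 ^ n := by positivity
  have : ((⌊b * 2 ^ n⌋ - ⌈a * 2 ^ n⌉ : ℤ) : ℝ) ≤ (((T * 2 ^ n : ℕ) : ℤ) : ℝ) := by
    push_cast
    nlinarith
  exact_mod_cast this

theorem two_pow_rpow (n : ℕ) (δ : ℝ) : ((2 : ℝ) ^ n) ^ δ = ((2 : ℝ) ^ δ) ^ n := by
  rw [← Real.rpow_natCast, ← Real.rpow_natCast, ← Real.rpow_mul (by norm_num),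
    ← Real.rpow_mul (by norm_num), mul_comm]

theorem summable_two_pow_rpow {δ : ℝ} (hδ : δ < 0) :
    Summable fun n : ℕ => ((2 : ℝ) ^ n) ^ δ := by
  simp_rw [two_pow_rpow]
  exact summable_geometric_of_lt_one (by positivity)
    (Real.rpow_lt_one_of_one_lt_of_neg (by norm_num) hδ)

/-! ### Power variation along dyadic partitions. -/

section

variable {Ω : Type*} [MeasurableSpace Ω] {P : Measure Ω} [IsProbabilityMeasure P]

/-- Power variations along dyadic partitions of a Gaussian field whose increments have variance of
order `2^{-nα}` and summable correlations, up to a power `γ < 1` of the number of increments. -/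
theorem ae_tendsto_dyadic_sum {X : ℕ → ℤ → Ω → ℝ} {a b α γ c₀ c₁ c₂ L : ℝ} (hab : a ≤ b)
    (hα0 : 0 < α) (hα2 : α < 2) (hγ : γ < 1) (hc₀ : 0 ≤ c₀) (hc₁ : 0 ≤ c₁) (hc₂ : 0 ≤ c₂)
    (hG : ∀ n, ∀ i ∈ dyadicIcc a b n, ∀ j ∈ dyadicIcc a b n,
      HasGaussianLaw (fun ω => (X n i ω, X n j ω)) P)
    (h0 : ∀ n, ∀ i ∈ dyadicIcc a b n, ∫ ω, X n i ω ∂P = 0)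
    (hs : ∀ n, ∀ i ∈ dyadicIcc a b n, ∫ ω, X n i ω * X n i ω ∂P ≤ c₀ * ((2 : ℝ) ^ n) ^ (-α))
    (hrow : ∀ n, ∀ i ∈ dyadicIcc a b n, ∑ j ∈ dyadicIcc a b n, |∫ ω, X n i ω * X n j ω ∂P| ≤
      c₁ * ((2 : ℝ) ^ n) ^ (γ - α) + c₂ * ((2 : ℝ) ^ n) ^ (-1 : ℝ))
    (hmean : Tendsto (fun n => ∑ i ∈ dyadicIcc a b n, (∫ ω, X n i ω * X n i ω ∂P) ^ (1 / α)) atTop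
      (𝓝 L)) :
    ∀ᵐ ω ∂P, Tendsto (fun n => ∑ i ∈ dyadicIcc a b n, |X n i ω| ^ (2 / α)) atTop
      (𝓝 (L * normalAbsMoment (2 / α))) := by
  refine ae_tendsto_sum_abs_rpow (s := fun n => c₀ * ((2 : ℝ) ^ n) ^ (-α))
    (by rw [le_div_iff₀ hα0]; linarith) hG h0 hs ?_ (by
      simpa only [show 2 / α / 2 = 1 / α by ring] using hmean)
  -- With N = 2^n, s^{p-1} is of order N^{α-2} and there are O(N) rows. The two parts of the row
  -- bound contribute N^{γ-1} and N^{α-2}, both geometric with ratio below 1.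
  have hmaj : Summable fun n : ℕ => c₀ ^ (2 / α - 1) * (b - a + 1) *
      (c₁ * ((2 : ℝ) ^ n) ^ (γ - 1) + c₂ * ((2 : ℝ) ^ n) ^ (α - 2)) :=
    (((summable_two_pow_rpow (by linarith)).mul_left _).add
      ((summable_two_pow_rpow (by linarith)).mul_left _)).mul_left _
  refine Summable.of_nonneg_of_le (fun n => by positivity) (fun n => ?_) hmaj
  have h2 : (0 : ℝ) < 2 ^ n := by positivity
  have hrows : ∑ i ∈ dyadicIcc a b n, ∑ j ∈ dyadicIcc a b n, |∫ ω, X n i ω * X n j ω ∂P| ≤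
      ((b - a + 1) * 2 ^ n) * (c₁ * ((2 : ℝ) ^ n) ^ (γ - α) + c₂ * ((2 : ℝ) ^ n) ^ (-1 : ℝ)) := by
    refine (Finset.sum_le_card_nsmul _ _ _ (hrow n)).trans ?_
    rw [nsmul_eq_mul]
    exact mul_le_mul_of_nonneg_right (card_dyadicIcc_le hab n) (by positivity)
  have e1 : (c₀ * ((2 : ℝ) ^ n) ^ (-α)) ^ (2 / α - 1) =
      c₀ ^ (2 / α - 1) * ((2 : ℝ) ^ n) ^ (α - 2) := by
    rw [Real.mul_rpow hc₀ (by positivity), ← Real.rpow_mul h2.le]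
    congr 2; field_simp; ring
  rw [e1]
  refine (mul_le_mul_of_nonneg_left hrows (by positivity)).trans (le_of_eq ?_)
  have e2 : ((2 : ℝ) ^ n) ^ (γ - 1) =
      ((2 : ℝ) ^ n) ^ (α - 2) * 2 ^ n * ((2 : ℝ) ^ n) ^ (γ - α) := by
    rw [← Real.rpow_add_one h2.ne', ← Real.rpow_add h2]; congr 1; ring
  have e3 : (2 : ℝ) ^ n * ((2 : ℝ) ^ n) ^ (-1 : ℝ) = 1 := by
    rw [Real.rpow_neg_one, mul_inv_cancel₀ h2.ne']
  calc _ = c₀ ^ (2 / α - 1) * (b - a + 1) * (c₁ * (((2 : ℝ) ^ n) ^ (α - 2) * 2 ^ n *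
        ((2 : ℝ) ^ n) ^ (γ - α)) + c₂ * ((2 : ℝ) ^ n) ^ (α - 2) *
        ((2 : ℝ) ^ n * ((2 : ℝ) ^ n) ^ (-1 : ℝ))) := by ring
    _ = _ := by rw [← e2, e3, mul_one]

end

/-! ### Variation in time. -/

theorem integral_sub_mul_sub {Ω : Type*} [MeasurableSpace Ω] {P : Measure Ω} {A B C D : Ω → ℝ}
    (hA : MemLp A 2 P) (hB : MemLp B 2 P) (hC : MemLp C 2 P) (hD : MemLp D 2 P) :
    ∫ ω, (A ω - B ω) * (C ω - D ω) ∂P =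
      ∫ ω, A ω * C ω ∂P - ∫ ω, A ω * D ω ∂P - ∫ ω, B ω * C ω ∂P + ∫ ω, B ω * D ω ∂P := by
  have iAC : Integrable (fun ω => A ω * C ω) P := hA.integrable_mul hC
  have iAD : Integrable (fun ω => A ω * D ω) P := hA.integrable_mul hD
  have iBC : Integrable (fun ω => B ω * C ω) P := hB.integrable_mul hC
  have iBD : Integrable (fun ω => B ω * D ω) P := hB.integrable_mul hD
  have i1 : Integrable (fun ω => A ω * C ω - A ω * D ω) P := iAC.sub iAD
  have i2 : Integrable (fun ω => B ω * C ω - B ω * D ω) P := iBC.sub iBD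
  have : ∀ ω, (A ω - B ω) * (C ω - D ω) =
      (A ω * C ω - A ω * D ω) - (B ω * C ω - B ω * D ω) := fun ω => by ring
  simp_rw [this]
  rw [integral_sub i1 i2, integral_sub iAC iAD, integral_sub iBC iBD]
  ring

/-- Half of the squared constant of the temporal variation. -/
def timeCoeff (H κ : ℝ) : ℝ :=
  noiseConst H * Real.Gamma (1 - H) * κ ^ (H - 1) / (H * 2 ^ H)

theorem timeCoeff_pos {H κ : ℝ} (hH0 : 0 < H) (hH1 : H < 1) (hκ : 0 < κ) : 0 < timeCoeff H κ := by
  have h1 := noiseConst_pos hH0 hH1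
  have h2 := Real.Gamma_pos_of_pos (s := 1 - H) (by linarith)
  unfold timeCoeff
  positivity

/-- The reflection formula cancels the sine and π of `noiseConst`, and Γ(2H+1) = 2HΓ(2H), so 2A is
the square of `timeConst`. -/
theorem two_mul_timeCoeff_rpow {H κ : ℝ} (hH0 : 0 < H) (hH1 : H < 1) (hκ : 0 < κ) :
    (2 * timeCoeff H κ) ^ (1 / H) = timeConst H κ ^ (2 / H) := by
  have hs : 0 < Real.sin (Real.pi * H) :=
    Real.sin_pos_of_pos_of_lt_pi (by positivity) (by nlinarith [Real.pi_pos])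
  have hG := Real.Gamma_pos_of_pos hH0
  have hG2 := Real.Gamma_pos_of_pos (s := 2 * H) (by linarith)
  have hrefl := Real.Gamma_mul_Gamma_one_sub H
  have e : 2 * timeCoeff H κ =
      (2 : ℝ) ^ (1 - H) * Real.Gamma (2 * H) / (κ ^ (1 - H) * Real.Gamma H) := by
    have h1 : Real.Gamma (1 - H) = Real.pi / Real.sin (Real.pi * H) / Real.Gamma H := by
      rw [← hrefl]; field_simp
    rw [timeCoeff, noiseConst, h1, Real.Gamma_add_one (by positivity), mul_comm H Real.pi,
      Real.rpow_sub (show (0 : ℝ) < 2 by norm_num), Real.rpow_sub hκ H, Real.rpow_sub hκ 1 H,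
      Real.rpow_one, Real.rpow_one]
    field_simp
  rw [timeConst, ← e, ← Real.rpow_mul (by rw [e]; positivity)]
  congr 1
  ring

section

variable {Ω : Type*} [MeasurableSpace Ω] {P : Measure Ω} {H κ : ℝ} {W : TestFun → Ω → ℝ}
  {u : ℝ → ℝ → Ω → ℝ}

/-- Covariance at a fixed space point. -/
theorem IsStochasticConvolution.integral_time_mul (hu : IsStochasticConvolution H κ P W u)
    (hW : IsFractionalNoise H P W) (hH0 : 0 < H) (hH1 : H < 1) (hκ : 0 < κ) {t s : ℝ}
    (ht : 0 ≤ t) (hs : 0 ≤ s) (x : ℝ) :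
    ∫ ω, u t x ω * u s x ω ∂P = timeCoeff H κ * ((t + s) ^ H - |t - s| ^ H) := by
  rw [hu.integral_mul hW hH0 hH1 hκ ht hs, sub_self, integral_heatCov_zero hH0 hH1 hκ ht hs, timeCoeff]

/-- Covariances of the dyadic time increments. -/
theorem IsStochasticConvolution.integral_time_increments (hu : IsStochasticConvolution H κ P W u)
    (hW : IsFractionalNoise H P W) (hH0 : 0 < H) (hH1 : H < 1) (hκ : 0 < κ) (x : ℝ) (n : ℕ)
    {i j : ℤ} (hi : 0 ≤ i) (hj : 0 ≤ j) :
    ∫ ω, (u (((i : ℝ) + 1) / 2 ^ n) x ω - u ((i : ℝ) / 2 ^ n) x ω) *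
      (u (((j : ℝ) + 1) / 2 ^ n) x ω - u ((j : ℝ) / 2 ^ n) x ω) ∂P =
      timeCoeff H κ * ((2 : ℝ) ^ n) ^ (-H) *
        (secondDiff H (i + j + 1) + secondDiff H (i - j)) := by
  have hi' : (0 : ℝ) ≤ i := by exact_mod_cast hi
  have hj' : (0 : ℝ) ≤ j := by exact_mod_cast hj
  have hN : (0 : ℝ) < 2 ^ n := by positivity
  have hpair : ∀ p q : ℝ, 0 ≤ p → 0 ≤ q → ∫ ω, u (p / 2 ^ n) x ω * u (q / 2 ^ n) x ω ∂P =
      timeCoeff H κ * ((2 : ℝ) ^ n) ^ (-H) * (|p + q| ^ H - |p - q| ^ H) := by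
    intro p q hp hq
    rw [hu.integral_time_mul hW hH0 hH1 hκ (by positivity) (by positivity), ← add_div, ← sub_div,
      abs_div, abs_of_pos hN, Real.div_rpow (by positivity) hN.le,
      Real.div_rpow (by positivity) hN.le, Real.rpow_neg hN.le, abs_of_nonneg (add_nonneg hp hq)]
    ring
  have hL : ∀ p : ℝ, 0 ≤ p → MemLp (u (p / 2 ^ n) x) 2 P := fun p hp =>
    (hu _ x (by positivity)).memLp
  rw [integral_sub_mul_sub (hL _ (by linarith)) (hL _ hi') (hL _ (by linarith)) (hL _ hj'),
    hpair _ _ (by linarith) (by linarith), hpair _ _ (by linarith) (by linarith),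
    hpair _ _ (by linarith) (by linarith), hpair _ _ (by linarith) (by linarith)]
  simp only [secondDiff]
  push_cast
  rw [show (i : ℝ) + 1 + (j + 1) = i + j + 1 + 1 by ring, show (i : ℝ) + 1 - (j + 1) = i - j by ring,
    show (i : ℝ) + 1 + j = i + j + 1 by ring, show (i : ℝ) + 1 - j = i - j + 1 by ring,
    show (i : ℝ) + (j + 1) = i + j + 1 by ring, show (i : ℝ) - (j + 1) = i - j - 1 by ring,
    show (i : ℝ) + j + 1 - 1 = i + j by ring]
  ring

theorem dyadicIcc_nonneg {a b : ℝ} (ha : 0 ≤ a) {n : ℕ} {i : ℤ} (hi : i ∈ dyadicIcc a b n) :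
    0 ≤ i := by
  rw [dyadicIcc, Finset.mem_Icc] at hi
  exact (Int.ceil_nonneg (by positivity)).trans hi.1

/-- In the concave case the telescoped bound does not depend on the number of terms. This controls
the non-stationary part of the time covariance, indexed by i + j + 1 or 2i + 1. -/
theorem sum_abs_secondDiff_comp_le {α : ℝ} (hα0 : 0 < α) (hα1 : α ≤ 1) {J : Finset ℤ} {e : ℤ → ℕ}
    (he : Set.InjOn e J) : ∑ j ∈ J, |secondDiff α ((e j : ℤ) + 1)| ≤ 2 := by
  classical
  refine (sum_comp_le_sum_range (F := fun m => |secondDiff α ((m : ℤ) + 1)|)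
    (N := J.sup e + 1) (fun m => abs_nonneg _) he
    (fun j hj => Nat.lt_succ_of_le (Finset.le_sup hj))).trans ?_
  refine (sum_abs_secondDiff_le hα0 (by linarith) _).trans ?_
  rw [max_eq_right (by linarith), Real.rpow_zero, mul_one]

theorem IsStochasticConvolution.ae_tendsto_time_variation [IsProbabilityMeasure P]
    (hu : IsStochasticConvolution H κ P W u)
    (hW : IsFractionalNoise H P W) (hH0 : 0 < H) (hH1 : H < 1) (hκ : 0 < κ) {x a b : ℝ}
    (ha : 0 ≤ a) (hab : a ≤ b) :
    ∀ᵐ ω ∂P, Tendsto (fun n : ℕ => dyadicVariation (fun t => u t x ω) (2 / H) a b n) atTop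
      (𝓝 ((b - a) * timeConst H κ ^ (2 / H) * normalAbsMoment (2 / H))) := by
  have hB := timeCoeff_pos hH0 hH1 hκ
  have hpos : ∀ {n : ℕ} {i : ℤ}, i ∈ dyadicIcc a b n →
      (0 : ℝ) ≤ ((i : ℝ) + 1) / 2 ^ n ∧ (0 : ℝ) ≤ (i : ℝ) / 2 ^ n := by
    intro n i hi
    have : (0 : ℝ) ≤ i := by exact_mod_cast dyadicIcc_nonneg ha hi
    constructor <;> positivity
  have hcov : ∀ n, ∀ i ∈ dyadicIcc a b n, ∀ j ∈ dyadicIcc a b n, _ := fun n i hi j hj =>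
    hu.integral_time_increments hW hH0 hH1 hκ x n (dyadicIcc_nonneg ha hi) (dyadicIcc_nonneg ha hj)
  have hdiag : ∀ n, ∀ i ∈ dyadicIcc a b n,
      ∫ ω, (u (((i : ℝ) + 1) / 2 ^ n) x ω - u ((i : ℝ) / 2 ^ n) x ω) *
        (u (((i : ℝ) + 1) / 2 ^ n) x ω - u ((i : ℝ) / 2 ^ n) x ω) ∂P =
      2 * timeCoeff H κ * ((2 : ℝ) ^ n) ^ (-H) * (1 + secondDiff H (i + i + 1) / 2) := by
    intro n i hi
    rw [hcov n i hi i hi, sub_self, secondDiff_zero hH0]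
    ring
  have hneg : ∀ n, ∀ i ∈ dyadicIcc a b n, secondDiff H (i + i + 1) ≤ 0 := by
    intro n i hi
    have := dyadicIcc_nonneg ha hi
    have h := secondDiff_nonpos hH0 hH1.le (i + i).toNat
    rwa [Int.toNat_of_nonneg (by omega)] at h
  -- The 8 in c₁ is 2 from the terms in i + j + 1 plus 6 from those in i - j. Since H < 1 both sums
  -- are bounded, whence γ = 0.
  refine ae_tendsto_dyadic_sum (X := fun n i ω => u (((i : ℝ) + 1) / 2 ^ n) x ω -
    u ((i : ℝ) / 2 ^ n) x ω) (γ := 0) (c₀ := 2 * timeCoeff H κ) (c₁ := 8 * timeCoeff H κ) (c₂ := 0)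
    hab hH0 (by linarith) (by norm_num) (by positivity) (by positivity) le_rfl ?_ ?_ ?_ ?_ ?_
  · intro n i hi j hj
    exact hW.hasGaussianLaw_sub_prodMk (hu _ x (hpos hi).1) (hu _ x (hpos hi).2)
      (hu _ x (hpos hj).1) (hu _ x (hpos hj).2)
  · intro n i hi
    rw [integral_sub ((hu _ x (hpos hi).1).memLp.integrable (by norm_num))
      ((hu _ x (hpos hi).2).memLp.integrable (by norm_num)),
      hW.integral_eq_zero (hu _ x (hpos hi).1), hW.integral_eq_zero (hu _ x (hpos hi).2), sub_zero]
  · intro n i hi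
    rw [hdiag n i hi]
    refine mul_le_of_le_one_right (by positivity) ?_
    linarith [hneg n i hi]
  · intro n i hi
    have hi0 := dyadicIcc_nonneg ha hi
    rw [zero_mul, add_zero, zero_sub]
    have h1 : ∑ j ∈ dyadicIcc a b n, |secondDiff H (i + j + 1)| ≤ 2 := by
      refine le_trans (le_of_eq (Finset.sum_congr rfl fun j hj => ?_))
        (sum_abs_secondDiff_comp_le hH0 hH1.le (J := dyadicIcc a b n)
          (e := fun j => (i + j).toNat) ?_)
      · have := dyadicIcc_nonneg ha hj
        rw [Int.toNat_of_nonneg (by omega)]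
      · intro j hj k hk hjk
        have := dyadicIcc_nonneg ha hj
        have := dyadicIcc_nonneg ha hk
        simp only at hjk
        omega
    have h2 : ∑ j ∈ dyadicIcc a b n, |secondDiff H (i - j)| ≤ 6 := by
      have := sum_abs_secondDiff_sub_le hH0 (by linarith) hi (Int.self_le_toNat _)
      rwa [max_eq_right (by linarith), Real.rpow_zero, mul_one] at this
    calc _ ≤ ∑ j ∈ dyadicIcc a b n, timeCoeff H κ * ((2 : ℝ) ^ n) ^ (-H) *
          (|secondDiff H (i + j + 1)| + |secondDiff H (i - j)|) := by
          refine Finset.sum_le_sum fun j hj => ?_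
          rw [hcov n i hi j hj, abs_mul, abs_of_nonneg (by positivity)]
          exact mul_le_mul_of_nonneg_left (abs_add_le _ _) (by positivity)
      _ = timeCoeff H κ * ((2 : ℝ) ^ n) ^ (-H) * (∑ j ∈ dyadicIcc a b n, |secondDiff H (i + j + 1)| +
          ∑ j ∈ dyadicIcc a b n, |secondDiff H (i - j)|) := by
          rw [← Finset.mul_sum, Finset.sum_add_distrib]
      _ ≤ timeCoeff H κ * ((2 : ℝ) ^ n) ^ (-H) * (2 + 6) := by gcongr
      _ = _ := by ring
  · set r : ℤ → ℝ := fun i => (1 + secondDiff H (i + i + 1) / 2) ^ (1 / H) with hr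
    have hterm : ∀ n, ∑ i ∈ dyadicIcc a b n,
        (∫ ω, (u (((i : ℝ) + 1) / 2 ^ n) x ω - u ((i : ℝ) / 2 ^ n) x ω) *
          (u (((i : ℝ) + 1) / 2 ^ n) x ω - u ((i : ℝ) / 2 ^ n) x ω) ∂P) ^ (1 / H) =
        timeConst H κ ^ (2 / H) * ((∑ i ∈ dyadicIcc a b n, r i) / 2 ^ n) := by
      intro n
      have hN : (0 : ℝ) < 2 ^ n := by positivity
      rw [Finset.sum_div, Finset.mul_sum]
      refine Finset.sum_congr rfl fun i hi => ?_
      have hnn : 0 ≤ 1 + secondDiff H (i + i + 1) / 2 := by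
        have h := hdiag n i hi
        have h0 : 0 ≤ ∫ ω, (u (((i : ℝ) + 1) / 2 ^ n) x ω - u ((i : ℝ) / 2 ^ n) x ω) *
          (u (((i : ℝ) + 1) / 2 ^ n) x ω - u ((i : ℝ) / 2 ^ n) x ω) ∂P :=
          integral_nonneg fun ω => mul_self_nonneg _
        rw [h] at h0
        exact nonneg_of_mul_nonneg_right h0 (by positivity)
      rw [hdiag n i hi, Real.mul_rpow (by positivity) hnn, Real.mul_rpow (by positivity)
        (by positivity), two_mul_timeCoeff_rpow hH0 hH1 hκ, ← Real.rpow_mul hN.le,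
        show -H * (1 / H) = -1 by field_simp, Real.rpow_neg_one]
      ring
    simp_rw [hterm]
    rw [mul_comm (b - a)]
    refine Tendsto.const_mul _ ?_
    -- The increments are not stationary near time 0, but the total deviation of the factors r i
    -- from 1 is bounded, hence invisible after division by 2^n.
    have hdiff : ∀ n, |(∑ i ∈ dyadicIcc a b n, r i) / 2 ^ n -
        ((dyadicIcc a b n).card : ℝ) / 2 ^ n| ≤ 1 / H * (1 / 2) ^ n := by
      intro n
      have hN : (0 : ℝ) < 2 ^ n := by positivity
      rw [← sub_div, abs_div, abs_of_pos hN, div_le_iff₀ hN, mul_assoc, div_pow, one_pow,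
        one_div_mul_cancel hN.ne', mul_one, Finset.cast_card, ← Finset.sum_sub_distrib]
      have h1 : ∑ i ∈ dyadicIcc a b n, |secondDiff H (i + i + 1)| ≤ 2 := by
        refine le_trans (le_of_eq (Finset.sum_congr rfl fun j hj => ?_))
          (sum_abs_secondDiff_comp_le hH0 hH1.le (J := dyadicIcc a b n)
            (e := fun j => (j + j).toNat) ?_)
        · have := dyadicIcc_nonneg ha hj
          rw [Int.toNat_of_nonneg (by omega)]
        · intro j hj k hk hjk
          have := dyadicIcc_nonneg ha hj
          have := dyadicIcc_nonneg ha hk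
          simp only at hjk
          omega
      calc _ ≤ ∑ i ∈ dyadicIcc a b n, |r i - 1| := Finset.abs_sum_le_sum_abs _ _
        _ ≤ ∑ i ∈ dyadicIcc a b n, 1 / H * (|secondDiff H (i + i + 1)| / 2) := by
          refine Finset.sum_le_sum fun i hi => ?_
          have hD := hneg n i hi
          have hnn : -1 ≤ secondDiff H (i + i + 1) / 2 := by
            have h := hdiag n i hi
            have h0 : 0 ≤ ∫ ω, (u (((i : ℝ) + 1) / 2 ^ n) x ω - u ((i : ℝ) / 2 ^ n) x ω) *
              (u (((i : ℝ) + 1) / 2 ^ n) x ω - u ((i : ℝ) / 2 ^ n) x ω) ∂P :=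
              integral_nonneg fun ω => mul_self_nonneg _
            rw [h] at h0
            have := nonneg_of_mul_nonneg_right h0 (by positivity)
            linarith
          have h2 : r i ≤ 1 := Real.rpow_le_one (by linarith) (by linarith) (by positivity)
          -- Bernoulli's inequality; its condition that the base be nonnegative is the nonnegativity
          -- of the variance.
          have h3 := one_add_mul_self_le_rpow_one_add hnn (p := 1 / H)
            (by rw [le_div_iff₀ hH0]; linarith)
          rw [abs_of_nonpos (by linarith), abs_of_nonpos hD]
          have : r i = (1 + secondDiff H (i + i + 1) / 2) ^ (1 / H) := rfl
          linarith
        _ = 1 / H * ((∑ i ∈ dyadicIcc a b n, |secondDiff H (i + i + 1)|) / 2) := by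
          rw [← Finset.mul_sum, Finset.sum_div]
        _ ≤ 1 / H * (2 / 2) := by gcongr
        _ = 1 / H := by ring
    have h0 : Tendsto (fun n : ℕ => 1 / H * ((1 : ℝ) / 2) ^ n) atTop (𝓝 0) := by
      simpa using (tendsto_pow_atTop_nhds_zero_of_lt_one (r := (1 : ℝ) / 2) (by norm_num)
        (by norm_num)).const_mul (1 / H)
    have h1 := squeeze_zero_norm (fun n => by rw [Real.norm_eq_abs]; exact hdiff n) h0
    have h2 := h1.add (tendsto_card_dyadicIcc_div hab)
    simpa using h2

/-! ### Variation in space. -/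

/-- Covariance at a fixed time. -/
theorem IsStochasticConvolution.integral_space_mul (hu : IsStochasticConvolution H κ P W u)
    (hW : IsFractionalNoise H P W) (hH0 : 0 < H) (hH1 : H < 1) (hκ : 0 < κ) {t : ℝ} (ht : 0 < t)
    (x y : ℝ) :
    ∫ ω, u t x ω * u t y ω ∂P = ∫ z, heatCov κ t t 0 z ∂(spectralMeasure H) -
      |x - y| ^ (2 * H) / (2 * κ) + spaceRemainder H κ t (x - y) := by
  rw [hu.integral_mul hW hH0 hH1 hκ ht.le ht.le]
  linarith [integral_heatCov_sub hH0 hH1 hκ ht (x - y)]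

theorem spaceRemainder_neg (H κ t d : ℝ) : spaceRemainder H κ t (-d) = spaceRemainder H κ t d := by
  simp only [spaceRemainder, mul_neg, Real.cos_neg]

theorem spaceRemainder_zero (H κ t : ℝ) : spaceRemainder H κ t 0 = 0 := by
  simp [spaceRemainder]

/-- Covariances of the dyadic space increments. -/
theorem IsStochasticConvolution.integral_space_increments (hu : IsStochasticConvolution H κ P W u)
    (hW : IsFractionalNoise H P W) (hH0 : 0 < H) (hH1 : H < 1) (hκ : 0 < κ) {t : ℝ} (ht : 0 < t)
    (n : ℕ) (i j : ℤ) :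
    ∫ ω, (u t (((i : ℝ) + 1) / 2 ^ n) ω - u t ((i : ℝ) / 2 ^ n) ω) *
      (u t (((j : ℝ) + 1) / 2 ^ n) ω - u t ((j : ℝ) / 2 ^ n) ω) ∂P =
      1 / (2 * κ) * ((2 : ℝ) ^ n) ^ (-(2 * H)) * secondDiff (2 * H) (i - j) -
        (spaceRemainder H κ t (((i : ℝ) - j) / 2 ^ n + 1 / 2 ^ n) +
          spaceRemainder H κ t (((i : ℝ) - j) / 2 ^ n - 1 / 2 ^ n) -
          2 * spaceRemainder H κ t (((i : ℝ) - j) / 2 ^ n)) := by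
  have hN : (0 : ℝ) < 2 ^ n := by positivity
  have hL : ∀ y : ℝ, MemLp (u t y) 2 P := fun y => (hu t y ht.le).memLp
  have hpow : ∀ p : ℝ, |p / 2 ^ n| ^ (2 * H) = ((2 : ℝ) ^ n) ^ (-(2 * H)) * |p| ^ (2 * H) := by
    intro p
    rw [abs_div, abs_of_pos hN, Real.div_rpow (abs_nonneg _) hN.le, Real.rpow_neg hN.le]
    ring
  rw [integral_sub_mul_sub (hL _) (hL _) (hL _) (hL _)]
  simp_rw [hu.integral_space_mul hW hH0 hH1 hκ ht, ← sub_div, ← add_div, hpow]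
  simp only [secondDiff]
  push_cast
  rw [show (i : ℝ) + 1 - (j + 1) = i - j by ring, show (i : ℝ) + 1 - j = i - j + 1 by ring,
    show (i : ℝ) - (j + 1) = i - j - 1 by ring]
  ring

theorem IsStochasticConvolution.ae_tendsto_space_variation [IsProbabilityMeasure P]
    (hu : IsStochasticConvolution H κ P W u)
    (hW : IsFractionalNoise H P W) (hH0 : 0 < H) (hH1 : H < 1) (hκ : 0 < κ) {t a b : ℝ}
    (ht : 0 < t) (hab : a ≤ b) :
    ∀ᵐ ω ∂P, Tendsto (fun n : ℕ => dyadicVariation (fun x => u t x ω) (1 / H) a b n) atTop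
      (𝓝 ((b - a) * spaceConst κ ^ (1 / H) * normalAbsMoment (1 / H))) := by
  obtain ⟨C, hC0, hC⟩ := exists_spaceRemainder_le hH0 hH1 hκ ht
  obtain ⟨T, hT⟩ := exists_nat_ge (b - a)
  have hcov := hu.integral_space_increments hW hH0 hH1 hκ ht
  have hdiag : ∀ (n : ℕ) (i : ℤ), ∫ ω, (u t (((i : ℝ) + 1) / 2 ^ n) ω - u t ((i : ℝ) / 2 ^ n) ω) *
      (u t (((i : ℝ) + 1) / 2 ^ n) ω - u t ((i : ℝ) / 2 ^ n) ω) ∂P =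
      1 / κ * ((2 : ℝ) ^ n) ^ (-(2 * H)) - 2 * spaceRemainder H κ t (1 / 2 ^ n) := by
    intro n i
    rw [hcov n i i, sub_self, sub_self, secondDiff_zero (by positivity), zero_div, zero_add, zero_sub,
      spaceRemainder_neg, spaceRemainder_zero]
    field_simp
    ring
  rw [show 1 / H = 2 / (2 * H) by field_simp]
  -- For H > 1/2 row sums grow like N^{2H-1}, still with γ < 1. In c₁, 3/κ is 6/(2κ), and T + 1
  -- absorbs T·2^n + 1 ≤ (T+1)2^n. In c₂, O(2^n) indices each carry an error 2C·4^{-n}.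
  set γ := max (2 * H - 1) 0 with hγ
  refine ae_tendsto_dyadic_sum (X := fun n i ω => u t (((i : ℝ) + 1) / 2 ^ n) ω -
    u t ((i : ℝ) / 2 ^ n) ω) (α := 2 * H) (γ := γ) (c₀ := 1 / κ)
    (c₁ := 3 / κ * ((T : ℝ) + 1) ^ γ) (c₂ := (b - a + 1) * (2 * C)) hab (by positivity)
    (by linarith) (max_lt (by linarith) (by norm_num)) (by positivity) (by positivity)
    (mul_nonneg (by linarith) (by positivity)) ?_ ?_ ?_ ?_ ?_
  · intro n i _ j _
    exact hW.hasGaussianLaw_sub_prodMk (hu t _ ht.le) (hu t _ ht.le) (hu t _ ht.le) (hu t _ ht.le)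
  · intro n i _
    rw [integral_sub ((hu t _ ht.le).memLp.integrable (by norm_num))
      ((hu t _ ht.le).memLp.integrable (by norm_num)),
      hW.integral_eq_zero (hu t _ ht.le), hW.integral_eq_zero (hu t _ ht.le), sub_zero]
  · intro n i _
    rw [hdiag n i]
    linarith [spaceRemainder_nonneg (t := t) hH0 hH1 hκ (1 / 2 ^ n)]
  · intro n i hi
    have hN : (0 : ℝ) < 2 ^ n := by positivity
    have h1 : ∑ j ∈ dyadicIcc a b n, |secondDiff (2 * H) (i - j)| ≤
        6 * (((T : ℝ) + 1) ^ γ * ((2 : ℝ) ^ n) ^ γ) := by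
      refine (sum_abs_secondDiff_sub_le (by positivity) (by linarith) hi
        (floor_sub_ceil_le hT n)).trans ?_
      rw [← Real.mul_rpow (by positivity) hN.le]
      have h2 : (1 : ℝ) ≤ 2 ^ n := one_le_pow₀ (by norm_num)
      gcongr
      push_cast
      linarith
    have h2 : ∀ j : ℤ, |∫ ω, (u t (((i : ℝ) + 1) / 2 ^ n) ω - u t ((i : ℝ) / 2 ^ n) ω) *
        (u t (((j : ℝ) + 1) / 2 ^ n) ω - u t ((j : ℝ) / 2 ^ n) ω) ∂P| ≤
        1 / (2 * κ) * ((2 : ℝ) ^ n) ^ (-(2 * H)) * |secondDiff (2 * H) (i - j)| +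
          2 * C * (1 / 2 ^ n) ^ 2 := by
      intro j
      rw [hcov n i j]
      refine (abs_sub _ _).trans (add_le_add ?_ ?_)
      · rw [abs_mul, abs_of_nonneg (by positivity)]
      · refine (abs_secondDiff_spaceRemainder_le hH0 hH1 hκ ht _ _).trans ?_
        linarith [hC (1 / 2 ^ n)]
    refine (Finset.sum_le_sum fun j _ => h2 j).trans ?_
    rw [Finset.sum_add_distrib, ← Finset.mul_sum, Finset.sum_const, nsmul_eq_mul]
    refine add_le_add ?_ ?_
    · refine (mul_le_mul_of_nonneg_left h1 (by positivity)).trans (le_of_eq ?_)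
      rw [show γ - 2 * H = -(2 * H) + γ by ring, Real.rpow_add hN]
      ring
    · refine (mul_le_mul_of_nonneg_right (card_dyadicIcc_le hab n) (by positivity)).trans
        (le_of_eq ?_)
      rw [Real.rpow_neg_one]
      field_simp
  · have hterm : ∀ n : ℕ, ∑ i ∈ dyadicIcc a b n,
        (∫ ω, (u t (((i : ℝ) + 1) / 2 ^ n) ω - u t ((i : ℝ) / 2 ^ n) ω) *
          (u t (((i : ℝ) + 1) / 2 ^ n) ω - u t ((i : ℝ) / 2 ^ n) ω) ∂P) ^ (1 / (2 * H)) =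
        ((dyadicIcc a b n).card : ℝ) / 2 ^ n *
          (1 / κ - 2 * (spaceRemainder H κ t (1 / 2 ^ n) * ((2 : ℝ) ^ n) ^ (2 * H))) ^
            (1 / (2 * H)) := by
      intro n
      have hN : (0 : ℝ) < 2 ^ n := by positivity
      have hNp : (0 : ℝ) < ((2 : ℝ) ^ n) ^ (2 * H) := by positivity
      have hd : 1 / κ * ((2 : ℝ) ^ n) ^ (-(2 * H)) - 2 * spaceRemainder H κ t (1 / 2 ^ n) =
          ((2 : ℝ) ^ n) ^ (-(2 * H)) *
            (1 / κ - 2 * (spaceRemainder H κ t (1 / 2 ^ n) * ((2 : ℝ) ^ n) ^ (2 * H))) := by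
        rw [Real.rpow_neg hN.le]; field_simp
      -- Spatial increments are stationary, so the sign can be read off the variance of the
      -- increment with index 0.
      have hnn : 0 ≤ 1 / κ - 2 * (spaceRemainder H κ t (1 / 2 ^ n) * ((2 : ℝ) ^ n) ^ (2 * H)) := by
        have h0 : 0 ≤ ∫ ω, (u t ((((0 : ℤ) : ℝ) + 1) / 2 ^ n) ω - u t (((0 : ℤ) : ℝ) / 2 ^ n) ω) *
          (u t ((((0 : ℤ) : ℝ) + 1) / 2 ^ n) ω - u t (((0 : ℤ) : ℝ) / 2 ^ n) ω) ∂P :=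
          integral_nonneg fun ω => mul_self_nonneg _
        rw [hdiag n 0, hd] at h0
        exact nonneg_of_mul_nonneg_right h0 (by positivity)
      rw [Finset.sum_congr rfl fun i _ => by rw [hdiag n i, hd], Finset.sum_const, nsmul_eq_mul,
        Real.mul_rpow (by positivity) hnn, ← Real.rpow_mul hN.le,
        show -(2 * H) * (1 / (2 * H)) = -1 by field_simp, Real.rpow_neg_one]
      ring
    simp_rw [hterm]
    have hzero : Tendsto (fun n : ℕ => spaceRemainder H κ t (1 / 2 ^ n) * ((2 : ℝ) ^ n) ^ (2 * H))
        atTop (𝓝 0) := by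
      have h0 : Tendsto (fun n : ℕ => C * ((2 : ℝ) ^ n) ^ (2 * H - 2)) atTop (𝓝 0) := by
        simpa using ((summable_two_pow_rpow (δ := 2 * H - 2)
          (by linarith)).tendsto_atTop_zero).const_mul C
      refine squeeze_zero (fun n => mul_nonneg (spaceRemainder_nonneg hH0 hH1 hκ _)
        (by positivity)) (fun n => ?_) h0
      have hN : (0 : ℝ) < 2 ^ n := by positivity
      refine (mul_le_mul_of_nonneg_right (hC _) (by positivity)).trans (le_of_eq ?_)
      rw [Real.rpow_sub hN, Real.rpow_two]
      field_simp
    have hconst : spaceConst κ ^ (2 / (2 * H)) = (1 / κ) ^ (1 / (2 * H)) := by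
      rw [spaceConst, ← Real.rpow_mul hκ.le, one_div κ, Real.inv_rpow hκ.le, ← Real.rpow_neg hκ.le]
      congr 1
      field_simp
    rw [hconst]
    refine (tendsto_card_dyadicIcc_div hab).mul ?_
    have h1 : Tendsto (fun n : ℕ => 1 / κ - 2 * (spaceRemainder H κ t (1 / 2 ^ n) *
        ((2 : ℝ) ^ n) ^ (2 * H))) atTop (𝓝 (1 / κ)) := by
      simpa using (hzero.const_mul 2).const_sub (1 / κ)
    exact h1.rpow_const (Or.inr (by positivity))

end

end FracHeat

end

theorem mainTheorem3 {Ω : Type*} [MeasurableSpace Ω] (P : Measure Ω) [IsProbabilityMeasure P]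
    (H κ : ℝ) (hH0 : 0 < H) (hH1 : H < 1) (hκ : 0 < κ)
    (W : FracHeat.TestFun → Ω → ℝ) (hW : FracHeat.IsFractionalNoise H P W)
    (u : ℝ → ℝ → Ω → ℝ) (hu : FracHeat.IsStochasticConvolution H κ P W u) :
    (∀ x a b : ℝ, 0 ≤ a → a ≤ b →
      ∀ᵐ ω ∂P, Tendsto
        (fun n : ℕ => FracHeat.dyadicVariation (fun t => u t x ω) (2 / H) a b n) atTop
        (𝓝 ((b - a) * FracHeat.timeConst H κ ^ (2 / H) * FracHeat.normalAbsMoment (2 / H)))) ∧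
    (∀ t : ℝ, 0 < t → ∀ c d : ℝ, c ≤ d →
      ∀ᵐ ω ∂P, Tendsto
        (fun n : ℕ => FracHeat.dyadicVariation (fun x => u t x ω) (1 / H) c d n) atTop
        (𝓝 ((d - c) * FracHeat.spaceConst κ ^ (1 / H) * FracHeat.normalAbsMoment (1 / H)))) := by
  exact ⟨fun x a b ha hab => hu.ae_tendsto_time_variation hW hH0 hH1 hκ ha hab,
    fun t ht c d hcd => hu.ae_tendsto_space_variation hW hH0 hH1 hκ ht hcd⟩
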